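/- \textbf{Setting.} Let $\mathbb Z_+=\{0,1,2,\dots\}$, $\mathbb Z_-=\{\dots,-2,-1,0\}$, $\mathbb N=\{1,2,\dots\}$. Let $b=(b(i))_{i\in\mathbb Z}$ be a two-sided simple symmetric random walk with $b(0)=0$, and let $\mathrm{DS}(b)=\{i\in\mathbb Z: b(i+1)=b(i)-1\}$ be its set of down-steps. Conditionally on $b$, let $T(i)$, $i\in \mathrm{DS}(b)$, be independent random finite rooted plane trees with integer vertex labels, where $T(i)$ has law $\rho_{b(i)}$; here $\rho_k$ gives mass $12^{-|\tau|}/2$ ($|\tau|$ being the number of edges) to each labelled plane tree $\tau$ whose root has label $k$ and whose labels differ by at most $1$ along each edge. Graft $T(i)$ in the upper half-plane at the point $i$ of the line $\mathbb Z$, and order the corners of all these trees that lie in the upper half-plane (the real corners) from left to right. A corner carries the label of its vertex. The successor $\mathrm{succ}(c)$ of a real corner $c$ is the first real corner to the right of $c$ whose label is that of $c$ minus $1$. The uniform infinite half-planar quadrangulation (UIHPQ, with general boundary) is the map whose vertices are the vertices of the trees $T(i)$, $i\in\mathrm{DS}(b)$, and whose edges join each real corner to its successor (all this is a.s. well defined).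 Its boundary is identified with $\mathbb Z$ through the map $\varphi$: if $i\in \mathrm{DS}(b)$, then $\varphi(i)$ is the root of $T(i)$; otherwise $\varphi(i)$ is the vertex of the first real corner to the right of $i$ with label $b(i)$. The sets $\varphi(\mathbb Z_+)$ and $\varphi(\mathbb Z_-)$ are the right and the left part of the boundary, and $\varphi(0)$ is the root vertex. The maximal geodesic $\gamma_{\max}=(\gamma_{\max}(j))_{j\in\mathbb Z_+}$ from the root is the sequence of vertices incident to $c,\mathrm{succ}(c),\mathrm{succ}(\mathrm{succ}(c)),\dots$, where $c$ is the leftmost real corner incident to $\varphi(0)$. Set $$\mathcal R_+=\{j\in\mathbb Z_+:\gamma_{\max}(j)\in\varphi(\mathbb Z_+)\},\qquad \mathcal R_-=\{j\in\mathbb Z_+:\gamma_{\max}(j)\in\varphi(\mathbb Z_-)\}.$$ \textbf{Proposition.} For every $i\in\mathbb N$, $$\mathbb P(i\in\mathcal R_+)=\frac1{i+1}\qquad\text{and}\qquad \mathbb P(i\in\mathcal R_-)=\frac3{i+3}.$$ Almost surely, both $\mathcal R_+$ and $\mathcal R_-$ are infinite, and $\gamma_{\max}$, which is almost surely a geodesic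 ray of the UIHPQ, hits the left as well as the right part of the boundary infinitely many times (that is, in infinitely many vertices). However, this happens with asymptotic frequency zero: almost surely, $$\lim_{n\to\infty}\frac{\#(\mathcal R_+\cap\{1,\dots,n\})}{n}=0\qquad\text{and}\qquad \lim_{n\to\infty}\frac{\#(\mathcal R_-\cap\{1,\dots,n\})}{n}=0.$$ -/

import Mathlib

open MeasureTheory ProbabilityTheory Filter Topology
open scoped ENNReal

namespace UIHPQ

/-- Finite plane forests with integer labels on the vertices. A forest is either empty, or it
consists of a first tree (whose root is labelled `ℓ` and whose subtrees above the root form the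
forest `sub`) followed by the forest `rest` of the remaining trees. -/
inductive LForest : Type
  | nil : LForest
  | cons (ℓ : ℤ) (sub rest : LForest) : LForest

/-- Number of vertices of a forest. -/
def LForest.numVertices : LForest → ℕ
  | .nil => 0
  | .cons _ sub rest => 1 + sub.numVertices + rest.numVertices

/-- `F.WellLabeled p`: if all roots of `F` are joined to a common parent vertex with label `p`,
then labels differ by at most one along every edge. -/
def LForest.WellLabeled : LForest → ℤ → Prop
  | .nil, _ => True
  | .cons ℓ sub rest, p => |ℓ - p| ≤ 1 ∧ sub.WellLabeled ℓ ∧ rest.WellLabeled p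

/-- Part of the left-to-right contour exploration of a plane tree. The trees of the forest hang,
as children number `k`, `k + 1`, ..., from a vertex with address `u` and label `p`. The list
records the (address, label) of the vertices incident to the corners that are explored after the
corner of `u` that lies just to the left of its child number `k`. -/
def LForest.contour : LForest → List ℕ → ℤ → ℕ → List (List ℕ × ℤ)
  | .nil, _, _, _ => []
  | .cons ℓ sub rest, u, p, k =>
      (u ++ [k], ℓ) :: (sub.contour (u ++ [k]) ℓ 0 ++ (u, p) :: rest.contour u p (k + 1))

/-- Finite rooted plane trees with integer labels: the label of the root, and the forest of the
subtrees above the root. -/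
structure LTree : Type where
  label : ℤ
  sub : LForest

/-- The number `|τ|` of edges of a tree. -/
def LTree.numEdges (t : LTree) : ℕ := t.sub.numVertices

/-- Labels differ by at most one along every edge. -/
def LTree.WellLabeled (t : LTree) : Prop := t.sub.WellLabeled t.label

/-- The corners of a plane tree in left-to-right contour order, each recorded as the pair
(address, label) of the vertex to which it is incident. Addresses are words of child positions, the
root having the empty word. A vertex with `k` children has `k + 1` corners (for the root: the
corners in the upper half-plane, once the root is grafted to the line). -/
def LTree.contour (t : LTree) : List (List ℕ × ℤ) := ([], t.label) :: t.sub.contour [] t.label 0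

/-- The Boltzmann measure `ρ_k` of the singleton `{t}`: it charges the well-labelled trees with
root label `k`, with mass `12 ^ (-|τ|) / 2`. -/
noncomputable def boltzmann (k : ℤ) (t : LTree) : ℝ≥0∞ :=
  open Classical in if t.label = k ∧ t.WellLabeled then ((12 : ℝ≥0∞) ^ t.numEdges)⁻¹ / 2 else 0

/-- The set of down-steps of a two-sided sequence. -/
def downSteps (b : ℤ → ℤ) : Set ℤ := {i | b (i + 1) = b i - 1}

/-- Infinite treed bridges. -/
structure TreedBridge : Type where
  b : ℤ → ℤ
  b_zero : b 0 = 0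
  abs_step : ∀ i, |b (i + 1) - b i| = 1
  T : downSteps b → LTree
  label_T : ∀ i, (T i).label = b i
  wellLabeled_T : ∀ i, (T i).WellLabeled

/-- `X` is, under `P`, a uniform infinite treed bridge: the bridge is a two-sided simple symmetric
random walk, and conditionally on the bridge `b` the trees attached to the down-steps `i` are
independent with respective laws `ρ_{b(i)}`. -/
structure IsUniformInfiniteTreedBridge {Ω : Type*} [MeasurableSpace Ω] (P : Measure Ω)
    (X : Ω → TreedBridge) : Prop where
  measurable_bridge : ∀ i : ℤ, Measurable fun ω => (X ω).b i
  measurable_tree : ∀ (i : ℤ) (t : LTree),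
    MeasurableSet {ω | ∃ h : i ∈ downSteps (X ω).b, (X ω).T ⟨i, h⟩ = t}
  indep_steps : iIndepFun (fun (i : ℤ) ω => (X ω).b (i + 1) - (X ω).b i) P
  prob_up : ∀ i : ℤ, P {ω | (X ω).b (i + 1) - (X ω).b i = 1} = 1 / 2
  prob_down : ∀ i : ℤ, P {ω | (X ω).b (i + 1) - (X ω).b i = -1} = 1 / 2
  cond_trees : ∀ (A : Set (ℤ → ℤ)), MeasurableSet A → ∀ (S : Finset ℤ) (t : ℤ → LTree),
    P {ω | (X ω).b ∈ A ∧ ∀ i ∈ S, ∃ h : i ∈ downSteps (X ω).b, (X ω).T ⟨i, h⟩ = t i} =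
      ∫⁻ ω in {ω | (X ω).b ∈ A ∧ ∀ i ∈ S, i ∈ downSteps (X ω).b},
        ∏ i ∈ S, boltzmann ((X ω).b i) (t i) ∂P

/-- Vertices of the trees are pairs (index of the tree, address of the vertex in the tree). -/
abbrev Vertex : Type := ℤ × List ℕ

namespace TreedBridge

/-- The real corners: pairs (down-step `i`, position in the contour of `T i`), with the
left-to-right order, which is the lexicographic order. -/
abbrev Corner (X : TreedBridge) : Type :=
  Σₗ i : downSteps X.b, Fin (X.T i).contour.length

variable (X : TreedBridge)

/-- The index of the tree in which a corner appears. -/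
def cornerIndex (c : X.Corner) : ℤ := ((ofLex c).1 : ℤ)

/-- The vertex incident to a corner. -/
def cornerVertex (c : X.Corner) : Vertex :=
  (X.cornerIndex c, ((X.T (ofLex c).1).contour.get (ofLex c).2).1)

/-- The label of (the vertex incident to) a corner. -/
def cornerLabel (c : X.Corner) : ℤ := ((X.T (ofLex c).1).contour.get (ofLex c).2).2

open Classical in
/-- The successor of a corner `c`: the first corner to the right of `c` with label
`ℓ(c) - 1`. It always exists if `b` is unbounded below on the nonnegative integers (otherwise the
value is meaningless). -/
noncomputable def succ (c : X.Corner) : X.Corner :=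
  if h : ∃ c', IsLeast {c' | c < c' ∧ X.cornerLabel c' = X.cornerLabel c - 1} c' then h.choose
  else c

/-- The graph of the quadrangulation encoded by the treed bridge (without edge multiplicities):
each real corner contributes one edge, drawn from the corner to its successor. Pairs that are not
vertices of the trees are isolated and play no role. -/
def graph : SimpleGraph Vertex :=
  SimpleGraph.fromRel fun u v => ∃ c, X.cornerVertex c = u ∧ X.cornerVertex (X.succ c) = v

open Classical in
/-- The identification `φ` of `ℤ` with the boundary of the quadrangulation: a down-step `i` is
mapped to itself, that is, to the root of `T i`; any other `i` is mapped to the vertex incident to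
the first real corner to the right of `i` with label `b i` (the value is meaningless if there is
none, which does not occur if `b` is unbounded below on the nonnegative integers). -/
noncomputable def boundaryMap (i : ℤ) : Vertex :=
  if i ∈ downSteps X.b then (i, [])
  else if h : ∃ c, IsLeast {c | i < X.cornerIndex c ∧ X.cornerLabel c = X.b i} c then
    X.cornerVertex h.choose
  else (i, [])

/-- The right part of the boundary. -/
def rightBoundary : Set Vertex := X.boundaryMap '' {i | 0 ≤ i}

/-- The left part of the boundary. -/
def leftBoundary : Set Vertex := X.boundaryMap '' {i | i ≤ 0}

/-- The root vertex of the quadrangulation: the root edge goes from `φ 0` to `φ 1`. -/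
noncomputable def root : Vertex := X.boundaryMap 0

open Classical in
/-- The maximal geodesic started at the vertex `v`: the vertices incident to the iterated successors
of the leftmost corner incident to `v`. -/
noncomputable def maxGeodesicFrom (v : Vertex) (n : ℕ) : Vertex :=
  if h : ∃ c, IsLeast {c | X.cornerVertex c = v} c then X.cornerVertex (X.succ^[n] h.choose) else v

/-- The maximal geodesic started at the root vertex. -/
noncomputable def maxGeodesic : ℕ → Vertex := X.maxGeodesicFrom X.root

/-- The times at which the maximal geodesic from the root hits the right part of the boundary. -/
def rightTimes : Set ℕ := {j | X.maxGeodesic j ∈ X.rightBoundary}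

/-- The times at which the maximal geodesic from the root hits the left part of the boundary. -/
def leftTimes : Set ℕ := {j | X.maxGeodesic j ∈ X.leftBoundary}

end TreedBridge

/-- A geodesic ray in a graph, given by its sequence of vertices. -/
def IsGeodesicRay {V : Type*} (G : SimpleGraph V) (γ : ℕ → V) : Prop :=
  ∀ i j : ℕ, G.dist (γ i) (γ j) = ((i : ℤ) - j).natAbs

/-- The set `R` of nonnegative integers has asymptotic frequency `x`:
`#(R ∩ {1, ..., n}) / n` tends to `x`. -/
def HasAsymptoticFrequency (R : Set ℕ) (x : ℝ) : Prop :=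
  Tendsto (fun n : ℕ => ((R ∩ Set.Icc 1 n).ncard : ℝ) / n) atTop (𝓝 x)

end UIHPQ

/-! Almost surely the bridge is unbounded below on the right. Then every real corner has a
successor, and the corner of the maximal geodesic at time j is the first real corner at or after 0
with label -j. Labels change by exactly one along each edge and drop by one at each step of this
path, which makes it a geodesic ray. Its j-th vertex is `φ i` exactly when b(i) = -j and this corner
is also the first one with label -j at or after i. Hence j belongs to R_+ iff the walk read
rightwards from 0 reaches -j after meeting only trees with labels above -j, and to R_- iff the same
holds for the walk read leftwards (`mem_rightTimes_iff`, `mem_leftTimes_iff`).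

A tree whose root lies k above a level stays above this level with probability p(k) =
k(k+3)/((k+1)(k+2)) (`boltzmannMass_gt`). Let g(k) be the probability to reach in this sense a level
k units below. A first-step decomposition gives 2g(k) = g(k+1) + p(k)g(k-1) on the right. On the
left, a down-step of the bridge is an upward move whose tree is rooted at the far end, so 2g(k) =
p(k+1)g(k+1) + g(k-1). With g(0) = 1 these are solved by 1/(k+1) and 3/(k+3). Recurrence of simple
random walk identifies the probabilities with these solutions (`abs_measure_chain_sub_le`).

For several levels the probabilities multiply over the gaps (`measure_chain`), so R_+ and R_- are
renewal sets. The sums of 1/(j+1) and of 3/(j+3) diverge, so both sets are infinite. The sum of P(j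
∈ R)/j converges, so the sum of 1/j over j ∈ R is almost surely finite, which forces frequency zero.
-/

namespace UIHPQ

/-! ### Generating functions of labelled forests -/

/-- The vertices of the forest all have labels satisfying `Q`. -/
def LForest.All (Q : ℤ → Prop) : LForest → Prop
  | .nil => True
  | .cons ℓ sub rest => Q ℓ ∧ sub.All Q ∧ rest.All Q

/-- The height of the binary tree that encodes a forest. -/
def LForest.height : LForest → ℕ
  | .nil => 0
  | .cons _ sub rest => max sub.height rest.height + 1

/-- Decomposition of a forest into its first tree and the remaining ones. -/
def LForest.equivSum : LForest ≃ Unit ⊕ (ℤ × LForest × LForest) where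
  toFun
    | .nil => Sum.inl ()
    | .cons ℓ s r => Sum.inr (ℓ, s, r)
  invFun
    | Sum.inl _ => .nil
    | Sum.inr (ℓ, s, r) => .cons ℓ s r
  left_inv := by rintro (_ | _) <;> rfl
  right_inv := by rintro (_ | ⟨_, _, _⟩) <;> rfl

def LTree.equivProd : LTree ≃ ℤ × LForest where
  toFun t := (t.label, t.sub)
  invFun p := ⟨p.1, p.2⟩
  left_inv _ := rfl
  right_inv _ := rfl

instance : Countable LForest := by
  have key : ∀ n : ℕ, {F : LForest | F.height < n}.Countable := by
    intro n
    induction n with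
    | zero => simp
    | succ n ih =>
      have : {F : LForest | F.height < n + 1} ⊆ {LForest.nil} ∪
          (fun p : ℤ × LForest × LForest => LForest.cons p.1 p.2.1 p.2.2) ''
            (Set.univ ×ˢ {F : LForest | F.height < n} ×ˢ {F : LForest | F.height < n}) := by
        rintro (_ | ⟨ℓ, s, r⟩) hF
        · simp
        · right
          simp only [LForest.height, Set.mem_ofPred_eq] at hF
          exact ⟨(ℓ, s, r), ⟨trivial, by simp; omega, by simp; omega⟩, rfl⟩
      refine Set.Countable.mono this ?_
      exact (Set.countable_singleton _).union
        ((Set.countable_univ.prod (ih.prod ih)).image _)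
  rw [← Set.countable_univ_iff]
  refine Set.Countable.mono ?_ (Set.countable_iUnion key)
  intro F _
  exact Set.mem_iUnion.2 ⟨F.height + 1, by simp⟩

instance : Countable LTree := LTree.equivProd.injective.countable

theorem LForest.tsum_eq (f : LForest → ℝ≥0∞) :
    ∑' F, f F = f .nil + ∑' (ℓ : ℤ) (s : LForest) (r : LForest), f (.cons ℓ s r) := by
  rw [← LForest.equivSum.symm.tsum_eq f,
    Summable.tsum_sum (f := fun i => f (LForest.equivSum.symm i)) ENNReal.summable ENNReal.summable]
  congr 1
  · simp [LForest.equivSum]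
  · rw [ENNReal.tsum_prod']
    refine tsum_congr fun ℓ => ?_
    rw [ENNReal.tsum_prod']
    rfl

open Classical in
/-- Boltzmann weight of a forest hanging from a vertex with label `p`, restricted to the labels
satisfying `Q`. -/
noncomputable def LForest.weight (Q : ℤ → Prop) (p : ℤ) (F : LForest) : ℝ≥0∞ :=
  if F.WellLabeled p ∧ F.All Q then ((12 : ℝ≥0∞) ^ F.numVertices)⁻¹ else 0

open Classical in
theorem LForest.weight_cons (Q : ℤ → Prop) (p ℓ : ℤ) (s r : LForest) :
    (LForest.cons ℓ s r).weight Q p =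
      (if |ℓ - p| ≤ 1 ∧ Q ℓ then 12⁻¹ else 0) * (s.weight Q ℓ * r.weight Q p) := by
  have h12 : ((12 : ℝ≥0∞) ^ (1 + s.numVertices + r.numVertices))⁻¹ =
      12⁻¹ * (((12 : ℝ≥0∞) ^ s.numVertices)⁻¹ * ((12 : ℝ≥0∞) ^ r.numVertices)⁻¹) := by
    rw [ENNReal.inv_pow, ENNReal.inv_pow, ENNReal.inv_pow, pow_add, pow_add, pow_one, mul_assoc]
  unfold LForest.weight
  simp only [LForest.WellLabeled, LForest.All, LForest.numVertices, h12]
  by_cases h1 : |ℓ - p| ≤ 1 <;> by_cases h2 : Q ℓ <;> by_cases h3 : s.WellLabeled ℓ <;>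
    by_cases h4 : s.All Q <;> by_cases h5 : r.WellLabeled p <;> by_cases h6 : r.All Q <;>
    simp [h1, h2, h3, h4, h5, h6]

theorem LForest.weight_nil (Q : ℤ → Prop) (p : ℤ) : LForest.nil.weight Q p = 1 := by
  simp [LForest.weight, LForest.WellLabeled, LForest.All, LForest.numVertices]

open Classical in
theorem tsum_near (Q : ℤ → Prop) (p : ℤ) (g : ℤ → ℝ≥0∞) :
    ∑' ℓ : ℤ, (if |ℓ - p| ≤ 1 ∧ Q ℓ then 12⁻¹ else 0) * g ℓ =
      12⁻¹ * ({ℓ | Q ℓ}.indicator g (p - 1) + {ℓ | Q ℓ}.indicator g p +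
        {ℓ | Q ℓ}.indicator g (p + 1)) := by
  rw [tsum_eq_sum (s := {p - 1, p, p + 1})]
  · rw [Finset.sum_insert (by simp; omega), Finset.sum_insert (by simp), Finset.sum_singleton]
    simp [Set.indicator_apply, mul_add, add_assoc]
  · intro ℓ hℓ
    have : ¬ |ℓ - p| ≤ 1 := by
      simp only [Finset.mem_insert, Finset.mem_singleton] at hℓ
      rw [abs_le]; omega
    simp [this]

/-- Partition function of the forests hanging from a vertex with label `p`, with all labels
satisfying `Q`. -/
noncomputable def forestSum (Q : ℤ → Prop) (p : ℤ) : ℝ≥0∞ := ∑' F : LForest, F.weight Q p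

/-- Decomposition at the first tree: its root costs 1/12 and has one of three labels, and the
subtrees above this root and the remaining trees are independent forests. -/
theorem forestSum_eq (Q : ℤ → Prop) (p : ℤ) :
    forestSum Q p = 1 + 12⁻¹ * ({ℓ | Q ℓ}.indicator (forestSum Q) (p - 1) +
      {ℓ | Q ℓ}.indicator (forestSum Q) p + {ℓ | Q ℓ}.indicator (forestSum Q) (p + 1)) *
        forestSum Q p := by
  conv_lhs => rw [forestSum, LForest.tsum_eq, LForest.weight_nil]
  simp only [LForest.weight_cons, ENNReal.tsum_mul_left, ENNReal.tsum_mul_right]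
  rw [← tsum_near, ← ENNReal.tsum_mul_right]
  simp only [forestSum, mul_assoc]

-- The partition function is the least solution of its equation: truncating at height n gives the
-- n-th iterate from below, and a supersolution dominates every iterate.
open Classical in
theorem forestSum_le (Q : ℤ → Prop) (r : ℤ → ℝ≥0∞)
    (hr : ∀ p, Q p → 1 + 12⁻¹ * (r (p - 1) + r p + r (p + 1)) * r p ≤ r p) {p : ℤ} (hp : Q p) :
    forestSum Q p ≤ r p := by
  have key : ∀ n : ℕ, ∀ p, Q p →
      ∑' F : LForest, (if F.height ≤ n then F.weight Q p else 0) ≤ r p := by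
    intro n
    induction n with
    | zero =>
      intro p hp
      rw [LForest.tsum_eq]
      simp only [LForest.height, le_refl, if_true, LForest.weight_nil]
      refine le_trans ?_ (hr p hp)
      simp
    | succ n ih =>
      intro p hp
      rw [LForest.tsum_eq]
      simp only [LForest.height, zero_le, if_true, LForest.weight_nil]
      refine le_trans ?_ (hr p hp)
      gcongr
      calc ∑' (ℓ : ℤ) (s : LForest) (t : LForest),
            (if max s.height t.height + 1 ≤ n + 1 then (LForest.cons ℓ s t).weight Q p else 0)
          = ∑' (ℓ : ℤ) (s : LForest) (t : LForest), (if |ℓ - p| ≤ 1 ∧ Q ℓ then 12⁻¹ else 0) *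
              ((if s.height ≤ n then s.weight Q ℓ else 0) *
                (if t.height ≤ n then t.weight Q p else 0)) := by
            refine tsum_congr fun ℓ => tsum_congr fun s => tsum_congr fun t => ?_
            rw [LForest.weight_cons]
            by_cases h1 : s.height ≤ n <;> by_cases h2 : t.height ≤ n <;> simp [h1, h2]
        _ = (∑' ℓ : ℤ, (if |ℓ - p| ≤ 1 ∧ Q ℓ then 12⁻¹ else 0) *
              ∑' s : LForest, (if s.height ≤ n then s.weight Q ℓ else 0)) *
                ∑' t : LForest, (if t.height ≤ n then t.weight Q p else 0) := by
            simp only [ENNReal.tsum_mul_left, ENNReal.tsum_mul_right]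
            rw [← ENNReal.tsum_mul_right]
            simp only [mul_assoc]
        _ ≤ _ := by
            refine mul_le_mul' ?_ (ih p hp)
            rw [tsum_near]
            have : ∀ ℓ, {ℓ | Q ℓ}.indicator (fun ℓ => ∑' s : LForest,
                (if s.height ≤ n then s.weight Q ℓ else 0)) ℓ ≤ r ℓ := by
              intro ℓ
              rw [Set.indicator_apply]
              split_ifs with h
              · exact ih ℓ h
              · exact zero_le
            gcongr <;> exact this _
  refine ENNReal.summable.tsum_le_of_sum_le fun s => ?_
  refine le_trans ?_ (key (s.sup LForest.height) p hp)
  refine le_trans (le_of_eq (Finset.sum_congr rfl fun F hF => ?_)) (ENNReal.sum_le_tsum s)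
  rw [if_pos (Finset.le_sup hF)]

/-! ### Probability that a Boltzmann tree stays above a level -/

/-- The probability that all labels of a tree with law `ρ_k` are positive. -/
noncomputable def posProb (k : ℝ) : ℝ := k * (k + 3) / ((k + 1) * (k + 2))

theorem posProb_nonneg (n : ℕ) : 0 ≤ posProb n := by unfold posProb; positivity

theorem posProb_le_one (n : ℕ) : posProb n ≤ 1 := by
  unfold posProb
  rw [div_le_one (by positivity)]
  nlinarith

theorem posProb_eq (n : ℕ) :
    2 * posProb (n + 1) = 1 + 12⁻¹ * (2 * posProb n + 2 * posProb (n + 1) + 2 * posProb (n + 2)) *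
      (2 * posProb (n + 1)) := by
  unfold posProb
  field_simp
  ring

/-- The gap d between the explicit solution and g is nonnegative, bounded and convex with d(0) = 0.
It grows at least like n d(1), so d(1) = 0, and the recursion then propagates the equality. -/
theorem eq_posProb_of_le (g : ℕ → ℝ) (h0 : g 0 = 0) (hpos : ∀ n, 0 < g (n + 1))
    (hle : ∀ n, g n ≤ 2 * posProb n)
    (hrec : ∀ n, g (n + 1) = 1 + 12⁻¹ * (g n + g (n + 1) + g (n + 2)) * g (n + 1)) (n : ℕ) :
    g n = 2 * posProb n := by
  set d : ℕ → ℝ := fun n => 2 * posProb n - g n with hd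
  have hd0 : d 0 = 0 := by simp [hd, h0, posProb]
  have hdn : ∀ n, 0 ≤ d n := fun n => by simp only [hd]; linarith [hle n]
  have hd2 : ∀ n, d n ≤ 2 := fun n => by
    simp only [hd]
    have := posProb_le_one n
    rcases n with _ | n
    · simp [h0, posProb]
    · linarith [hpos n]
  have hconv : ∀ n, 2 * d (n + 1) - d n ≤ d (n + 2) := by
    intro n
    have e1 := posProb_eq n
    have e2 := hrec n
    have hp := posProb_le_one (n + 1)
    have hl := hle (n + 1)
    have hg := hpos n
    have hdd := hdn (n + 1)
    simp only [hd] at hdd ⊢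
    push_cast at *
    set a := posProb (n : ℝ)
    set b := posProb ((n : ℝ) + 1)
    set c := posProb ((n : ℝ) + 2)
    have hb : 0 < b := by linarith
    have s1 : 2 * a + 2 * b + 2 * c = 12 * (1 - 1 / (2 * b)) := by field_simp; linarith
    have s2 : g n + g (n + 1) + g (n + 2) = 12 * (1 - 1 / g (n + 1)) := by field_simp; linarith
    -- Both solutions are at most 2, so the difference of reciprocals is at least a quarter of d;
    -- 12/4 = 3 is exactly the constant that makes d convex.
    have s3 : 3 * (2 * b - g (n + 1)) ≤ 12 * (1 / g (n + 1) - 1 / (2 * b)) := by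
      have : 1 / g (n + 1) - 1 / (2 * b) = (2 * b - g (n + 1)) / (g (n + 1) * (2 * b)) := by
        field_simp
      rw [this, mul_div_assoc', le_div_iff₀ (by positivity)]
      have : g (n + 1) * (2 * b) ≤ 4 := by nlinarith
      nlinarith
    linarith
  have hmono : ∀ n, d 1 ≤ d (n + 1) - d n := by
    intro n
    induction n with
    | zero => simp [hd0]
    | succ n ih => linarith [hconv n]
  have hlin : ∀ n : ℕ, n * d 1 ≤ d n := by
    intro n
    induction n with
    | zero => simp [hd0]
    | succ n ih => push_cast; linarith [hmono n]
  have hd1 : d 1 = 0 := by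
    by_contra hne
    have hp : 0 < d 1 := lt_of_le_of_ne (hdn 1) (Ne.symm hne)
    obtain ⟨N, hN⟩ := exists_nat_gt (2 / d 1)
    rw [div_lt_iff₀ hp] at hN
    linarith [hlin N, hd2 N]
  have hz : ∀ n, d n = 0 ∧ d (n + 1) = 0 := by
    intro n
    induction n with
    | zero => exact ⟨hd0, hd1⟩
    | succ n ih =>
      refine ⟨ih.2, ?_⟩
      have e1 := posProb_eq n
      have e2 := hrec n
      have hg := (hpos n).ne'
      obtain ⟨i1, i2⟩ := ih
      simp only [hd] at i1 i2 ⊢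
      push_cast at *
      have j2 : 2 * posProb ((n : ℝ) + 1) = g (n + 1) := by linarith
      have j1 : 2 * posProb (n : ℝ) = g n := by linarith
      rw [j2, j1] at e1
      rw [show (n : ℝ) + 1 + 1 = n + 2 by ring]
      have : 12⁻¹ * (g n + g (n + 1) + 2 * posProb ((n : ℝ) + 2)) * g (n + 1) =
        12⁻¹ * (g n + g (n + 1) + g (n + 2)) * g (n + 1) := by linarith
      have := mul_right_cancel₀ hg this
      linarith
  have := (hz n).1
  simp only [hd] at this
  linarith

/-- Minimality (`forestSum_le`) bounds the partition function by the explicit solution, and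
`eq_posProb_of_le` turns the bound into an equality. -/
theorem forestSum_gt (t : ℤ) (n : ℕ) :
    forestSum (fun ℓ => t < ℓ) (t + (n + 1 : ℕ)) = ENNReal.ofReal (2 * posProb (n + 1 : ℕ)) := by
  set Q : ℤ → Prop := fun ℓ => t < ℓ
  have hle : ∀ n : ℕ, forestSum Q (t + (n + 1 : ℕ)) ≤ ENNReal.ofReal (2 * posProb (n + 1 : ℕ)) := by
    intro n
    -- The truncation `toNat` is harmless: only neighbours at height 0 or more above t occur, and
    -- `posProb 0 = 0` accounts for the forbidden level t.
    have := forestSum_le Q (fun p => ENNReal.ofReal (2 * posProb ((p - t).toNat : ℕ)))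
      (p := t + (n + 1 : ℕ)) ?_ (by simp only [Q]; omega)
    · simpa using this
    · intro p hp
      obtain ⟨k, rfl⟩ : ∃ k : ℕ, p = t + (k + 1 : ℕ) :=
        ⟨(p - t - 1).toNat, by simp only [Q] at hp; omega⟩
      have h1 : (t + (k + 1 : ℕ) - 1 - t).toNat = k := by omega
      have h2 : (t + (k + 1 : ℕ) - t).toNat = k + 1 := by omega
      have h3 : (t + (k + 1 : ℕ) + 1 - t).toNat = k + 2 := by omega
      simp only [h1, h2, h3]
      have p1 := posProb_nonneg k
      have p2 := posProb_nonneg (k + 1)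
      have p3 := posProb_nonneg (k + 2)
      rw [show (12 : ℝ≥0∞)⁻¹ = ENNReal.ofReal 12⁻¹ by
          rw [ENNReal.ofReal_inv_of_pos (by norm_num)]; norm_num,
        show (1 : ℝ≥0∞) = ENNReal.ofReal 1 by simp,
        ← ENNReal.ofReal_add (by positivity) (by positivity),
        ← ENNReal.ofReal_add (by positivity) (by positivity),
        ← ENNReal.ofReal_mul (by positivity), ← ENNReal.ofReal_mul (by positivity),
        ← ENNReal.ofReal_add (by positivity) (by positivity)]
      refine le_of_eq (congrArg _ ?_)
      have := posProb_eq k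
      push_cast
      exact this.symm
  have hfin : ∀ n : ℕ, forestSum Q (t + (n + 1 : ℕ)) ≠ ∞ := fun n =>
    ne_top_of_le_ne_top ENNReal.ofReal_ne_top (hle n)
  set g : ℕ → ℝ := fun n => ({ℓ | Q ℓ}.indicator (forestSum Q) (t + n)).toReal with hg
  have hgs : ∀ n : ℕ, g (n + 1) = (forestSum Q (t + (n + 1 : ℕ))).toReal := by
    intro n
    simp only [hg]
    rw [Set.indicator_of_mem]
    simp only [Q, Set.mem_ofPred_eq]; omega
  have hone : ∀ n : ℕ, 1 ≤ forestSum Q (t + (n + 1 : ℕ)) := fun n => by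
    rw [forestSum_eq]; exact le_self_add
  have hindfin : ∀ n : ℕ, {ℓ | Q ℓ}.indicator (forestSum Q) (t + n) ≠ ∞ := by
    rintro (_ | n)
    · simp [Q]
    · rw [Set.indicator_of_mem (by simp only [Q, Set.mem_ofPred_eq]; omega)]
      exact hfin n
  have key := eq_posProb_of_le g (by simp [hg, Q]) ?_ ?_ ?_ (n + 1)
  · rw [← key, hgs, ENNReal.ofReal_toReal (hfin n)]
  · intro n
    rw [hgs]
    exact ENNReal.toReal_pos (zero_lt_one.trans_le (hone n)).ne' (hfin n)
  · rintro (_ | n)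
    · simp [hg, Q, posProb]
    · rw [hgs]
      exact ENNReal.toReal_le_of_le_ofReal (by have := posProb_nonneg (n + 1); positivity) (hle n)
  · intro n
    have e : forestSum Q (t + (n + 1 : ℕ)) = 1 + 12⁻¹ *
        ({ℓ | Q ℓ}.indicator (forestSum Q) (t + n) +
          {ℓ | Q ℓ}.indicator (forestSum Q) (t + (n + 1 : ℕ)) +
          {ℓ | Q ℓ}.indicator (forestSum Q) (t + (n + 2 : ℕ))) *
          forestSum Q (t + (n + 1 : ℕ)) := by
      conv_lhs => rw [forestSum_eq]
      rw [show t + ((n + 1 : ℕ) : ℤ) - 1 = t + n by push_cast; ring,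
        show t + ((n + 1 : ℕ) : ℤ) + 1 = t + (n + 2 : ℕ) by push_cast; ring]
    have f1 := hindfin n
    have f2 := hindfin (n + 1)
    have f3 := hindfin (n + 2)
    have e' := congrArg ENNReal.toReal e
    rw [ENNReal.toReal_add (by simp) (ENNReal.mul_ne_top (ENNReal.mul_ne_top (by simp)
        (ENNReal.add_ne_top.2 ⟨ENNReal.add_ne_top.2 ⟨f1, f2⟩, f3⟩)) (hfin n)),
      ENNReal.toReal_mul, ENNReal.toReal_mul,
      ENNReal.toReal_add (ENNReal.add_ne_top.2 ⟨f1, f2⟩) f3, ENNReal.toReal_add f1 f2,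
      ← hgs n] at e'
    simpa [hg, -Nat.cast_add] using e'

/-- The mass that the Boltzmann measure `ρ_k` gives to a set of trees. -/
noncomputable def boltzmannMass (k : ℤ) (B : Set LTree) : ℝ≥0∞ :=
  ∑' τ, B.indicator (boltzmann k) τ

/-- The trees all of whose labels satisfy `Q`. -/
def LTree.All (Q : ℤ → Prop) (τ : LTree) : Prop := Q τ.label ∧ τ.sub.All Q

theorem boltzmannMass_all {Q : ℤ → Prop} {k : ℤ} (hk : Q k) :
    boltzmannMass k {τ | τ.All Q} = forestSum Q k / 2 := by
  classical
  rw [boltzmannMass, ← LTree.equivProd.symm.tsum_eq, ENNReal.tsum_prod', tsum_eq_single k]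
  · rw [forestSum, ENNReal.div_eq_inv_mul, ← ENNReal.tsum_mul_left]
    refine tsum_congr fun F => ?_
    simp only [LTree.equivProd, Equiv.coe_fn_symm_mk, Set.indicator_apply, Set.mem_ofPred_eq,
      LTree.All, hk, true_and, boltzmann, LTree.WellLabeled, LForest.weight, LTree.numEdges]
    by_cases h1 : F.All Q <;> by_cases h2 : F.WellLabeled k <;>
      simp [h1, h2, ENNReal.div_eq_inv_mul]
  · intro ℓ hℓ
    refine ENNReal.tsum_eq_zero.2 fun F => ?_
    simp [LTree.equivProd, Set.indicator_apply, boltzmann, hℓ]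

theorem boltzmannMass_gt (t : ℤ) (n : ℕ) :
    boltzmannMass (t + (n + 1 : ℕ)) {τ | τ.All (t < ·)} = ENNReal.ofReal (posProb (n + 1 : ℕ)) := by
  rw [boltzmannMass_all (by omega), forestSum_gt, ENNReal.ofReal_mul (by norm_num),
    ENNReal.ofReal_ofNat, mul_comm, ENNReal.mul_div_cancel_right (by norm_num) (by norm_num)]

/-- The constant 2 solves x = 1 + x²/4, which bounds the mass above by 1. The bound below comes from
trees staying above a level that tends to -∞. -/
theorem boltzmannMass_univ (k : ℤ) : boltzmannMass k Set.univ = 1 := by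
  apply le_antisymm
  · have h : boltzmannMass k {τ | τ.All fun _ => True} ≤ 1 := by
      rw [boltzmannMass_all trivial]
      refine ENNReal.div_le_of_le_mul ?_
      rw [one_mul]
      refine forestSum_le _ (fun _ => 2) (fun p _ => ?_) trivial
      rw [show (2 : ℝ≥0∞) + 2 + 2 = 6 by norm_num, mul_assoc, show (6 : ℝ≥0∞) * 2 = 12 by norm_num,
        ENNReal.inv_mul_cancel (by norm_num) (by norm_num)]
      norm_num
    refine le_trans (le_of_eq ?_) h
    have hall : ∀ F : LForest, F.All fun _ => True := by
      intro F
      induction F with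
      | nil => trivial
      | cons ℓ s r hs hr => exact ⟨trivial, hs, hr⟩
    congr
    exact (Set.eq_univ_of_forall fun τ => show τ.All _ from ⟨trivial, hall _⟩).symm
  · have hlim : Tendsto (fun n : ℕ => ENNReal.ofReal (posProb (n + 1 : ℕ))) atTop (𝓝 1) := by
      rw [← ENNReal.ofReal_one]
      refine ENNReal.tendsto_ofReal ?_
      have h2 : Tendsto (fun n : ℕ => 1 - 2 * (1 / ((n : ℝ) + 1))) atTop (𝓝 1) := by
        simpa using (tendsto_one_div_add_atTop_nhds_zero_nat (𝕜 := ℝ)).const_mul 2 |>.const_sub 1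
      refine tendsto_of_tendsto_of_tendsto_of_le_of_le h2 tendsto_const_nhds (fun n => ?_)
        fun n => posProb_le_one _
      simp only [posProb]
      push_cast
      rw [← sub_nonneg]
      have : (n + 1 : ℝ) * (n + 1 + 3) / ((n + 1 + 1) * (n + 1 + 2)) - (1 - 2 * (1 / (n + 1))) =
        (2 * n ^ 2 + 8 * n + 10) / ((n + 1) * (n + 1 + 1) * (n + 1 + 2)) := by
        field_simp
        ring
      rw [this]
      positivity
    refine le_of_tendsto hlim (Eventually.of_forall fun n => ?_)
    have := boltzmannMass_gt (k - (n + 1 : ℕ)) n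
    rw [sub_add_cancel] at this
    rw [← this]
    exact ENNReal.tsum_le_tsum fun τ => Set.indicator_le_indicator_of_subset (Set.subset_univ _)
      (fun _ => zero_le) τ

end UIHPQ

/-! ### Conditional law of the trees given the bridge -/

namespace UIHPQ

theorem boltzmannMass_singleton (k : ℤ) (τ : LTree) : boltzmannMass k {τ} = boltzmann k τ := by
  rw [boltzmannMass, ← tsum_subtype]
  exact tsum_singleton τ _

/-- The event that `i` is a down-step, whose tree belongs to `B`. -/
def treeEvent {Ω : Type*} (X : Ω → TreedBridge) (i : ℤ) (B : Set LTree) : Set Ω :=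
  {ω | ∃ h : i ∈ downSteps (X ω).b, (X ω).T ⟨i, h⟩ ∈ B}

section Trees

variable {Ω : Type*} [MeasurableSpace Ω] {P : Measure Ω} {X : Ω → TreedBridge}

theorem IsUniformInfiniteTreedBridge.measurableSet_treeEvent
    (hX : IsUniformInfiniteTreedBridge P X) (i : ℤ) (B : Set LTree) :
    MeasurableSet (treeEvent X i B) := by
  have : treeEvent X i B = ⋃ τ ∈ B, {ω | ∃ h : i ∈ downSteps (X ω).b, (X ω).T ⟨i, h⟩ = τ} := by
    ext ω
    simp [treeEvent]
  rw [this]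
  exact MeasurableSet.biUnion B.to_countable fun τ _ => hX.measurable_tree i τ

theorem IsUniformInfiniteTreedBridge.measurableSet_bridge
    (hX : IsUniformInfiniteTreedBridge P X) {A : Set (ℤ → ℤ)} (hA : MeasurableSet A) :
    MeasurableSet {ω | (X ω).b ∈ A} :=
  measurable_pi_lambda _ hX.measurable_bridge hA

theorem IsUniformInfiniteTreedBridge.measurable_comp_bridge
    (hX : IsUniformInfiniteTreedBridge P X) (f : ℤ → ℝ≥0∞) (i : ℤ) :
    Measurable fun ω => f ((X ω).b i) :=
  measurable_from_top.comp (hX.measurable_bridge i)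

theorem IsUniformInfiniteTreedBridge.measurableSet_trees
    (hX : IsUniformInfiniteTreedBridge P X) {A : Set (ℤ → ℤ)} (hA : MeasurableSet A)
    (S : Finset ℤ) (B : ℤ → Set LTree) :
    MeasurableSet {ω | (X ω).b ∈ A ∧ ∀ i ∈ S, ω ∈ treeEvent X i (B i)} := by
  have : {ω | (X ω).b ∈ A ∧ ∀ i ∈ S, ω ∈ treeEvent X i (B i)} =
      {ω | (X ω).b ∈ A} ∩ ⋂ i ∈ S, treeEvent X i (B i) := by
    ext ω; simp
  rw [this]
  exact (hX.measurableSet_bridge hA).inter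
    (Finset.measurableSet_biInter S fun i _ => hX.measurableSet_treeEvent i _)

/-- Conditionally on the bridge, the trees are independent with Boltzmann laws. -/
theorem IsUniformInfiniteTreedBridge.measure_trees
    (hX : IsUniformInfiniteTreedBridge P X) {A : Set (ℤ → ℤ)} (hA : MeasurableSet A)
    (S : Finset ℤ) (B : ℤ → Set LTree) :
    P {ω | (X ω).b ∈ A ∧ ∀ i ∈ S, ω ∈ treeEvent X i (B i)} =
      ∫⁻ ω in {ω | (X ω).b ∈ A ∧ ∀ i ∈ S, i ∈ downSteps (X ω).b},
        ∏ i ∈ S, boltzmannMass ((X ω).b i) (B i) ∂P := by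
  classical
  -- The set U contains the indices whose constraint is not yet a single tree. Each induction step
  -- splits one constraint into its countably many trees.
  suffices key : ∀ (U : Finset ℤ) (B : ℤ → Set LTree), (∀ i ∈ S, i ∉ U → ∃ τ, B i = {τ}) →
      P {ω | (X ω).b ∈ A ∧ ∀ i ∈ S, ω ∈ treeEvent X i (B i)} =
        ∫⁻ ω in {ω | (X ω).b ∈ A ∧ ∀ i ∈ S, i ∈ downSteps (X ω).b},
          ∏ i ∈ S, boltzmannMass ((X ω).b i) (B i) ∂P from
    key S B fun i h1 h2 => absurd h1 h2
  intro U
  induction U using Finset.induction_on with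
  | empty =>
    intro B hB
    have : ∀ i, ∃ τ, i ∈ S → B i = {τ} := fun i => by
      by_cases hi : i ∈ S
      · obtain ⟨τ, hτ⟩ := hB i hi (by simp)
        exact ⟨τ, fun _ => hτ⟩
      · exact ⟨⟨0, .nil⟩, fun h => absurd h hi⟩
    choose t ht using this
    have h1 : {ω | (X ω).b ∈ A ∧ ∀ i ∈ S, ω ∈ treeEvent X i (B i)} =
        {ω | (X ω).b ∈ A ∧ ∀ i ∈ S, ∃ h : i ∈ downSteps (X ω).b, (X ω).T ⟨i, h⟩ = t i} := by
      ext ω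
      refine and_congr_right fun _ => forall₂_congr fun i hi => ?_
      simp [treeEvent, ht i hi]
    rw [h1, hX.cond_trees A hA S t]
    refine lintegral_congr fun ω => Finset.prod_congr rfl fun i hi => ?_
    rw [ht i hi, boltzmannMass_singleton]
  | insert u U hu ih =>
    intro B hB
    by_cases huS : u ∈ S
    swap
    · exact ih B fun i hi hiU => hB i hi (by
        rw [Finset.mem_insert, not_or]; exact ⟨fun h => huS (h ▸ hi), hiU⟩)
    have hun : {ω | (X ω).b ∈ A ∧ ∀ i ∈ S, ω ∈ treeEvent X i (B i)} =
        ⋃ τ : B u, {ω | (X ω).b ∈ A ∧ ∀ i ∈ S,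
          ω ∈ treeEvent X i (Function.update B u {(τ : LTree)} i)} := by
      ext ω
      simp only [Set.mem_ofPred_eq, Set.mem_iUnion]
      constructor
      · rintro ⟨h1, h2⟩
        obtain ⟨h, hh⟩ := h2 u huS
        refine ⟨⟨_, hh⟩, h1, fun i hi => ?_⟩
        rcases eq_or_ne i u with rfl | hne
        · rw [Function.update_self]; exact ⟨h, rfl⟩
        · rw [Function.update_of_ne hne]; exact h2 i hi
      · rintro ⟨τ, h1, h2⟩
        refine ⟨h1, fun i hi => ?_⟩
        rcases eq_or_ne i u with rfl | hne
        · obtain ⟨h, hh⟩ := h2 i hi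
          rw [Function.update_self] at hh
          exact ⟨h, by rw [Set.mem_singleton_iff.1 hh]; exact τ.2⟩
        · have := h2 i hi
          rwa [Function.update_of_ne hne] at this
    rw [hun, measure_iUnion]
    · have hstep : ∀ τ : B u, P {ω | (X ω).b ∈ A ∧ ∀ i ∈ S,
          ω ∈ treeEvent X i (Function.update B u {(τ : LTree)} i)} =
          ∫⁻ ω in {ω | (X ω).b ∈ A ∧ ∀ i ∈ S, i ∈ downSteps (X ω).b},
            boltzmann ((X ω).b u) τ * ∏ i ∈ S.erase u, boltzmannMass ((X ω).b i) (B i) ∂P := by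
        intro τ
        rw [ih]
        · refine lintegral_congr fun ω => ?_
          rw [← Finset.mul_prod_erase S _ huS, Function.update_self, boltzmannMass_singleton]
          congr 1
          refine Finset.prod_congr rfl fun i hi => ?_
          rw [Function.update_of_ne (Finset.ne_of_mem_erase hi)]
        · intro i hi hiU
          rcases eq_or_ne i u with rfl | hne
          · exact ⟨τ, by rw [Function.update_self]⟩
          · rw [Function.update_of_ne hne]
            exact hB i hi (by simp [hne, hiU])
      rw [tsum_congr hstep, ← lintegral_tsum]
      · refine lintegral_congr fun ω => ?_
        rw [ENNReal.tsum_mul_right, ← Finset.mul_prod_erase S _ huS, boltzmannMass, ← tsum_subtype]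
      · intro τ
        exact ((hX.measurable_comp_bridge (fun k => boltzmann k τ) u).mul
          (Finset.measurable_prod _ fun i _ =>
            hX.measurable_comp_bridge (fun k => boltzmannMass k (B i)) i)).aemeasurable
    · intro τ τ' hne
      refine Set.disjoint_left.2 fun ω h1 h2 => hne ?_
      obtain ⟨_, h⟩ := h1.2 u huS
      obtain ⟨_, h'⟩ := h2.2 u huS
      rw [Function.update_self, Set.mem_singleton_iff] at h h'
      exact Subtype.ext (h.symm.trans h')
    · exact fun τ => hX.measurableSet_trees hA S _

/-- Once the bridge event fixes the root labels, the integrand is constant and the conditional law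
factorizes. -/
theorem IsUniformInfiniteTreedBridge.measure_trees_of_const
    (hX : IsUniformInfiniteTreedBridge P X) {A : Set (ℤ → ℤ)} (hA : MeasurableSet A)
    (S : Finset ℤ) (B : ℤ → Set LTree) (v : ℤ → ℤ)
    (hv : ∀ β ∈ A, ∀ i ∈ S, i ∈ downSteps β ∧ β i = v i) :
    P {ω | (X ω).b ∈ A ∧ ∀ i ∈ S, ω ∈ treeEvent X i (B i)} =
      P {ω | (X ω).b ∈ A} * ∏ i ∈ S, boltzmannMass (v i) (B i) := by
  have h1 : {ω | (X ω).b ∈ A ∧ ∀ i ∈ S, i ∈ downSteps (X ω).b} = {ω | (X ω).b ∈ A} := by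
    ext ω
    exact and_iff_left_of_imp fun h i hi => (hv _ h i hi).1
  rw [hX.measure_trees hA, h1, setLIntegral_congr_fun (g := fun _ =>
    ∏ i ∈ S, boltzmannMass (v i) (B i)) (hX.measurableSet_bridge hA), setLIntegral_const, mul_comm]
  intro ω hω
  exact Finset.prod_congr rfl fun i hi => by rw [(hv _ hω i hi).2]

end Trees

/-! ### Exploring one side of the bridge step by step -/

/-- The `n`-th integer point on the right (`s = true`) or on the left (`s = false`) of `0`. -/
def pos (s : Bool) (n : ℕ) : ℤ := if s then n else -n

/-- The left end of the `n`-th unit interval on the right or on the left of `0`. -/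
def edge (s : Bool) (n : ℕ) : ℤ := if s then n else -n - 1

/-- The sign converts an increment read away from 0 into an increment read from left to right. -/
def sgn (s : Bool) : ℤ := if s then 1 else -1

theorem edge_injective (s : Bool) : Function.Injective (edge s) := by
  intro m n h
  cases s <;> simp [edge] at h <;> omega

/-- Reading leftwards reverses increments, so a down-step of the bridge is seen as an upward move on
the left side. -/
theorem step_edge (s : Bool) (β : ℤ → ℤ) (n : ℕ) :
    β (edge s n + 1) - β (edge s n) = sgn s * (β (pos s (n + 1)) - β (pos s n)) := by
  cases s
  · simp only [edge, pos, sgn, Bool.false_eq_true, if_false]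
    rw [show (-(n : ℤ) - 1 + 1) = -n by ring, show -(n : ℤ) - 1 = -(n + 1 : ℕ) by push_cast; ring]
    ring
  · simp [edge, pos, sgn]

theorem mem_downSteps_edge (s : Bool) (β : ℤ → ℤ) (n : ℕ) :
    edge s n ∈ downSteps β ↔ sgn s * (β (pos s (n + 1)) - β (pos s n)) = -1 := by
  rw [← step_edge, downSteps, Set.mem_ofPred_eq]
  omega

/-- The functions that agree with `z` on the points `0, ..., m` of one side. -/
def cyl (s : Bool) (z : ℕ → ℤ) (m : ℕ) : Set (ℤ → ℤ) := {β | ∀ n ≤ m, β (pos s n) = z n}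

theorem measurableSet_cyl (s : Bool) (z : ℕ → ℤ) (m : ℕ) : MeasurableSet (cyl s z m) := by
  have : cyl s z m = ⋂ n ∈ Set.Iic m, (fun β : ℤ → ℤ => β (pos s n)) ⁻¹' {z n} := by
    ext β; simp [cyl]
  rw [this]
  exact MeasurableSet.biInter (Set.to_countable _) fun n _ =>
    measurable_pi_apply _ (measurableSet_singleton _)

theorem cyl_congr (s : Bool) {z z' : ℕ → ℤ} {m : ℕ} (h : ∀ n ≤ m, z n = z' n) :
    cyl s z m = cyl s z' m := by
  ext β
  exact forall₂_congr fun n hn => by rw [h n hn]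

theorem mem_cyl_succ (s : Bool) (z : ℕ → ℤ) (m : ℕ) (β : ℤ → ℤ) :
    β ∈ cyl s z (m + 1) ↔ β ∈ cyl s z m ∧ β (pos s (m + 1)) = z (m + 1) := by
  constructor
  · exact fun h => ⟨fun n hn => h n (by omega), h _ le_rfl⟩
  · rintro ⟨h1, h2⟩ n hn
    rcases Nat.le_succ_iff.1 hn with h | rfl
    · exact h1 n h
    · exact h2

/-- Events that prescribe the path of the bridge between `0` and the `m`-th point of one side, where
the bridge takes the value `x`, and restrict the trees attached to this part of the bridge. -/
def IsAtom {Ω : Type*} (X : Ω → TreedBridge) (s : Bool) (m : ℕ) (x : ℤ) (E : Set Ω) : Prop :=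
  ∃ (z : ℕ → ℤ) (S : Finset ℤ) (B : ℤ → Set LTree) (v : ℤ → ℤ), z 0 = 0 ∧ z m = x ∧
    S ⊆ (Finset.range m).image (edge s) ∧
    (∀ β ∈ cyl s z m, ∀ i ∈ S, i ∈ downSteps β ∧ β i = v i) ∧
    E = {ω | (X ω).b ∈ cyl s z m ∧ ∀ i ∈ S, ω ∈ treeEvent X i (B i)}

theorem isAtom_univ {Ω : Type*} (X : Ω → TreedBridge) (s : Bool) : IsAtom X s 0 0 Set.univ := by
  refine ⟨fun _ => 0, ∅, fun _ => ∅, fun _ => 0, rfl, rfl, by simp, by simp, ?_⟩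
  ext ω
  simp [cyl, pos, (X ω).b_zero]

theorem IsAtom.eq_of_mem {Ω : Type*} {X : Ω → TreedBridge} {s : Bool} {m : ℕ} {x : ℤ}
    {E : Set Ω} (hE : IsAtom X s m x E) {ω : Ω}
    (hω : ω ∈ E) : (X ω).b (pos s m) = x := by
  obtain ⟨z, S, B, v, h0, hm, hS, hv, rfl⟩ := hE
  rw [← hm]
  exact hω.1 m le_rfl

section Atoms

variable {Ω : Type*} [MeasurableSpace Ω] {P : Measure Ω} {X : Ω → TreedBridge}

theorem IsUniformInfiniteTreedBridge.measure_step (hX : IsUniformInfiniteTreedBridge P X)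
    (i : ℤ) {δ : ℤ} (hδ : |δ| = 1) : P {ω | (X ω).b (i + 1) - (X ω).b i = δ} = 2⁻¹ := by
  rcases (abs_eq zero_le_one).1 hδ with rfl | rfl
  · rw [hX.prob_up, one_div]
  · rw [hX.prob_down, one_div]

theorem IsUniformInfiniteTreedBridge.measure_cyl (hX : IsUniformInfiniteTreedBridge P X)
    [IsProbabilityMeasure P] (s : Bool) (z : ℕ → ℤ) (h0 : z 0 = 0) (m : ℕ) :
    P {ω | (X ω).b ∈ cyl s z m} = ∏ n ∈ Finset.range m,
      P {ω | (X ω).b (edge s n + 1) - (X ω).b (edge s n) = sgn s * (z (n + 1) - z n)} := by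
  have hind := hX.indep_steps.precomp (edge_injective s)
  have := hind.measure_inter_preimage_eq_mul (S := Finset.range m)
    (sets := fun n => {sgn s * (z (n + 1) - z n)}) (fun n _ => measurableSet_singleton _)
  refine Eq.trans (congrArg P ?_) this
  clear this
  ext ω
  simp only [Set.mem_iInter, Finset.mem_range, Set.mem_preimage, Set.mem_singleton_iff,
    Set.mem_ofPred_eq, step_edge]
  have hs : ∀ a b : ℤ, sgn s * a = sgn s * b ↔ a = b := by
    intro a b; cases s <;> simp [sgn]
  induction m with
  | zero => simp [cyl, pos, h0, (X ω).b_zero]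
  | succ m ih =>
    rw [mem_cyl_succ]
    constructor
    · rintro ⟨h0, h2⟩ n hn
      have h1 := ih.1 h0
      rcases Nat.lt_succ_iff_lt_or_eq.1 hn with h | rfl
      · exact h1 n h
      · have := h0 n le_rfl
        rw [hs, this, h2]
    · intro h
      have h1 : ∀ n < m, _ := fun n hn => h n (Nat.lt_succ_of_lt hn)
      refine ⟨ih.2 h1, ?_⟩
      have e1 := (ih.2 h1) m le_rfl
      have e2 := (hs _ _).1 (h m (Nat.lt_succ_self m))
      linarith

theorem IsUniformInfiniteTreedBridge.measure_cyl_succ (hX : IsUniformInfiniteTreedBridge P X)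
    [IsProbabilityMeasure P] (s : Bool) (z : ℕ → ℤ) (h0 : z 0 = 0) (m : ℕ)
    (hz : |z (m + 1) - z m| = 1) :
    P {ω | (X ω).b ∈ cyl s z (m + 1)} = 2⁻¹ * P {ω | (X ω).b ∈ cyl s z m} := by
  rw [hX.measure_cyl s z h0, hX.measure_cyl s z h0, Finset.prod_range_succ, mul_comm]
  congr 1
  refine hX.measure_step _ ?_
  cases s <;> simpa [sgn, abs_sub_comm] using hz

theorem IsAtom.step [IsProbabilityMeasure P]
    (hX : IsUniformInfiniteTreedBridge P X) {s : Bool} {m : ℕ} {x : ℤ}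
    {E : Set Ω} (hE : IsAtom X s m x E) {δ : ℤ} (hδ : |δ| = 1) :
    IsAtom X s (m + 1) (x + δ) (E ∩ {ω | (X ω).b (pos s (m + 1)) = x + δ}) ∧
      P (E ∩ {ω | (X ω).b (pos s (m + 1)) = x + δ}) = 2⁻¹ * P E := by
  obtain ⟨z, S, B, v, h0, hm, hS, hv, rfl⟩ := hE
  set z' := Function.update z (m + 1) (x + δ) with hz'
  have hz'n : ∀ n ≤ m, z' n = z n := fun n hn => Function.update_of_ne (by omega) _ _
  have hc : cyl s z' m = cyl s z m := cyl_congr s hz'n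
  have h0' : z' 0 = 0 := by rw [hz'n 0 (Nat.zero_le _), h0]
  have hm' : z' (m + 1) = x + δ := Function.update_self _ _ _
  have hv' : ∀ β ∈ cyl s z' (m + 1), ∀ i ∈ S, i ∈ downSteps β ∧ β i = v i := fun β hβ i hi =>
    hv β (hc ▸ ((mem_cyl_succ s z' m β).1 hβ).1) i hi
  have hset : {ω | (X ω).b ∈ cyl s z m ∧ ∀ i ∈ S, ω ∈ treeEvent X i (B i)} ∩
      {ω | (X ω).b (pos s (m + 1)) = x + δ} =
      {ω | (X ω).b ∈ cyl s z' (m + 1) ∧ ∀ i ∈ S, ω ∈ treeEvent X i (B i)} := by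
    ext ω
    simp only [Set.mem_inter_iff, Set.mem_ofPred_eq, mem_cyl_succ, hc, hm']
    tauto
  refine ⟨⟨z', S, B, v, h0', hm', hS.trans (Finset.image_subset_image (by simp)), hv', hset⟩, ?_⟩
  rw [hset, hX.measure_trees_of_const (measurableSet_cyl _ _ _) S B v hv',
    hX.measure_trees_of_const (measurableSet_cyl _ _ _) S B v hv,
    hX.measure_cyl_succ s z' h0' m (by rw [hm', hz'n m le_rfl, hm]; simpa using hδ), hc, mul_assoc]

/-- The tree sits at the left end of the new edge: this is the current point when reading
rightwards, and the new point when reading leftwards. This is the source of the asymmetry between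
the two sides. -/
theorem IsAtom.step_tree [IsProbabilityMeasure P]
    (hX : IsUniformInfiniteTreedBridge P X) {s : Bool} {m : ℕ} {x : ℤ}
    {E : Set Ω} (hE : IsAtom X s m x E) {δ : ℤ} (hδ : sgn s * δ = -1) (C : Set LTree) :
    IsAtom X s (m + 1) (x + δ)
        (E ∩ {ω | (X ω).b (pos s (m + 1)) = x + δ} ∩ treeEvent X (edge s m) C) ∧
      P (E ∩ {ω | (X ω).b (pos s (m + 1)) = x + δ} ∩ treeEvent X (edge s m) C) =
        2⁻¹ * boltzmannMass (if s then x else x + δ) C * P E := by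
  classical
  have hδ1 : |δ| = 1 := by
    cases s
    · have : δ = 1 := by simp only [sgn] at hδ; simpa using hδ
      simp [this]
    · have : δ = -1 := by simp only [sgn] at hδ; simpa using hδ
      simp [this]
  obtain ⟨z, S, B, v, h0, hm, hS, hv, rfl⟩ := hE
  set z' := Function.update z (m + 1) (x + δ) with hz'
  set y : ℤ := if s then x else x + δ with hy
  have hz'n : ∀ n ≤ m, z' n = z n := fun n hn => Function.update_of_ne (by omega) _ _
  have hc : cyl s z' m = cyl s z m := cyl_congr s hz'n
  have h0' : z' 0 = 0 := by rw [hz'n 0 (Nat.zero_le _), h0]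
  have hm' : z' (m + 1) = x + δ := Function.update_self _ _ _
  have heS : edge s m ∉ S := fun h => by
    obtain ⟨n, hn, he⟩ := Finset.mem_image.1 (hS h)
    rw [edge_injective s he] at hn
    simp at hn
  have hne : ∀ i ∈ S, i ≠ edge s m := fun i hi h => heS (h ▸ hi)
  have hv' : ∀ β ∈ cyl s z' (m + 1), ∀ i ∈ insert (edge s m) S,
      i ∈ downSteps β ∧ β i = Function.update v (edge s m) y i := by
    intro β hβ i hi
    obtain ⟨hβ1, hβ2⟩ := (mem_cyl_succ s z' m β).1 hβ
    rw [hc] at hβ1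
    have hβm : β (pos s m) = x := by rw [hβ1 m le_rfl, hm]
    rw [hm'] at hβ2
    rcases Finset.mem_insert.1 hi with rfl | hi
    · refine ⟨by rw [mem_downSteps_edge, hβ2, hβm]; simpa using hδ, ?_⟩
      rw [Function.update_self, hy]
      cases s
      · simp only [edge, pos, Bool.false_eq_true, if_false] at hβ2 ⊢
        rw [← hβ2]
        congr 1
        push_cast
        ring
      · simpa [edge, pos] using hβm
    · rw [Function.update_of_ne (hne i hi)]
      exact hv β hβ1 i hi
  have hset : {ω | (X ω).b ∈ cyl s z m ∧ ∀ i ∈ S, ω ∈ treeEvent X i (B i)} ∩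
      {ω | (X ω).b (pos s (m + 1)) = x + δ} ∩ treeEvent X (edge s m) C =
      {ω | (X ω).b ∈ cyl s z' (m + 1) ∧ ∀ i ∈ insert (edge s m) S,
        ω ∈ treeEvent X i (Function.update B (edge s m) C i)} := by
    ext ω
    have : (∀ i ∈ S, ω ∈ treeEvent X i (Function.update B (edge s m) C i)) ↔
        ∀ i ∈ S, ω ∈ treeEvent X i (B i) :=
      forall₂_congr fun i hi => by rw [Function.update_of_ne (hne i hi)]
    simp only [Set.mem_inter_iff, Set.mem_ofPred_eq, mem_cyl_succ, hc, hm',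
      Finset.forall_mem_insert, Function.update_self, this]
    tauto
  refine ⟨⟨z', insert (edge s m) S, _, _, h0', hm', ?_, hv', hset⟩, ?_⟩
  · refine Finset.insert_subset (Finset.mem_image_of_mem _ (by simp)) ?_
    exact hS.trans (Finset.image_subset_image (by simp))
  · rw [hset, hX.measure_trees_of_const (measurableSet_cyl _ _ _) _ _ _ hv',
      hX.measure_trees_of_const (measurableSet_cyl _ _ _) S B v hv,
      hX.measure_cyl_succ s z' h0' m (by rw [hm', hz'n m le_rfl, hm]; simpa using hδ1), hc,
      Finset.prod_insert heS, Function.update_self, Function.update_self,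
      Finset.prod_congr rfl fun i hi => by
        rw [Function.update_of_ne (hne i hi), Function.update_of_ne (hne i hi)]]
    ring

end Atoms

end UIHPQ

/-! ### Recurrence of the simple random walk -/

namespace UIHPQ

/-- The probability that a simple random walk started at `k` does not hit `0` within `n` steps. -/
noncomputable def survival : ℕ → ℕ → ℝ
  | 0, 0 => 0
  | 0, _ + 1 => 1
  | _ + 1, 0 => 0
  | n + 1, k + 1 => (survival n k + survival n (k + 2)) / 2

theorem survival_zero_right (n : ℕ) : survival n 0 = 0 := by cases n <;> rfl

theorem survival_nonneg (n k : ℕ) : 0 ≤ survival n k := by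
  induction n generalizing k with
  | zero => cases k <;> simp [survival]
  | succ n ih =>
    cases k with
    | zero => simp [survival]
    | succ k => simp only [survival]; linarith [ih k, ih (k + 2)]

theorem survival_le_one (n k : ℕ) : survival n k ≤ 1 := by
  induction n generalizing k with
  | zero => cases k <;> simp [survival]
  | succ n ih =>
    cases k with
    | zero => simp [survival]
    | succ k => simp only [survival]; linarith [ih k, ih (k + 2)]

theorem survival_succ_le (n k : ℕ) : survival (n + 1) k ≤ survival n k := by
  induction n generalizing k with
  | zero =>
    cases k with
    | zero => simp [survival]
    | succ k => exact survival_le_one _ _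
  | succ n ih =>
    cases k with
    | zero => simp [survival]
    | succ k =>
      change (survival (n + 1) k + survival (n + 1) (k + 2)) / 2 ≤
        (survival n k + survival n (k + 2)) / 2
      linarith [ih k, ih (k + 2)]

/-- The limit in n is a harmonic function of k that vanishes at 0, hence linear, and boundedness
leaves only zero. -/
theorem tendsto_survival (k : ℕ) : Tendsto (fun n => survival n k) atTop (𝓝 0) := by
  have hbdd : ∀ k, BddBelow (Set.range fun n => survival n k) := fun k =>
    ⟨0, by rintro _ ⟨n, rfl⟩; exact survival_nonneg n k⟩
  have hlim : ∀ k, Tendsto (fun n => survival n k) atTop (𝓝 (⨅ n, survival n k)) := fun k =>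
    tendsto_atTop_ciInf (antitone_nat_of_succ_le fun n => survival_succ_le n k) (hbdd k)
  set u : ℕ → ℝ := fun k => ⨅ n, survival n k with hu
  have h0 : u 0 = 0 := by simp [hu, survival_zero_right]
  have h1 : ∀ k, u k ≤ 1 := fun k => (ciInf_le (hbdd k) 0).trans (survival_le_one 0 k)
  have hn : ∀ k, 0 ≤ u k := fun k => le_ciInf fun n => survival_nonneg n k
  have hrec : ∀ k, u (k + 1) = (u k + u (k + 2)) / 2 := fun k =>
    tendsto_nhds_unique ((hlim (k + 1)).comp (tendsto_add_atTop_nat 1))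
      (((hlim k).add (hlim (k + 2))).div_const 2)
  have hlin : ∀ k : ℕ, u k = k * u 1 ∧ u (k + 1) = (k + 1) * u 1 := by
    intro k
    induction k with
    | zero => simp [h0]
    | succ k ih =>
      refine ⟨by push_cast; exact ih.2, ?_⟩
      push_cast
      linarith [hrec k, ih.1, ih.2]
  have hu1 : u 1 = 0 := by
    by_contra hne
    have hp : 0 < u 1 := lt_of_le_of_ne (hn 1) (Ne.symm hne)
    obtain ⟨N, hN⟩ := exists_nat_gt (1 / u 1)
    rw [div_lt_iff₀ hp] at hN
    linarith [(hlin N).1, h1 N]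
  have := hlim k
  rwa [show (⨅ n, survival n k) = 0 from (hlin k).1.trans (by rw [hu1, mul_zero])] at this

/-! ### Probability of reaching successive levels -/

/-- The tree at the `n`-th edge of one side, if there is one, belongs to `C t`. -/
def TreeOk (Y : TreedBridge) (s : Bool) (C : ℤ → Set LTree) (n : ℕ) (t : ℤ) : Prop :=
  ∀ h : edge s n ∈ downSteps Y.b, Y.T ⟨edge s n, h⟩ ∈ C t

/-- The bridge, read on one side from the `m`-th point, first reaches the level `t` at the
`N`-th point, and all trees met before belong to `C t`. -/
def Reach (Y : TreedBridge) (s : Bool) (C : ℤ → Set LTree) (m : ℕ) (t : ℤ) (N : ℕ) : Prop :=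
  m ≤ N ∧ Y.b (pos s N) = t ∧ ∀ n, m ≤ n → n < N → t < Y.b (pos s n) ∧ TreeOk Y s C n t

/-- The bridge successively reaches the levels of a list. -/
def Chain (Y : TreedBridge) (s : Bool) (C : ℤ → Set LTree) : ℕ → List ℤ → Prop
  | _, [] => True
  | m, t :: L => ∃ N, Reach Y s C m t N ∧ Chain Y s C N L

variable {Y : TreedBridge} {s : Bool} {C : ℤ → Set LTree}

theorem chain_cons_of_eq {m : ℕ} {t : ℤ} {L : List ℤ} (h : Y.b (pos s m) = t) :
    Chain Y s C m (t :: L) ↔ Chain Y s C m L := by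
  constructor
  · rintro ⟨N, ⟨h1, h2, h3⟩, hL⟩
    rcases h1.eq_or_lt with rfl | hlt
    · exact hL
    · exact absurd h (h3 m le_rfl hlt).1.ne'
  · exact fun hL => ⟨m, ⟨le_rfl, h, fun n h1 h2 => absurd h2 (by omega)⟩, hL⟩

theorem chain_cons_of_lt {m : ℕ} {t : ℤ} {L : List ℤ} (h : t < Y.b (pos s m)) :
    Chain Y s C m (t :: L) ↔ TreeOk Y s C m t ∧ Chain Y s C (m + 1) (t :: L) := by
  constructor
  · rintro ⟨N, ⟨h1, h2, h3⟩, hL⟩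
    rcases h1.eq_or_lt with rfl | hlt
    · exact absurd h2 h.ne'
    · exact ⟨(h3 m le_rfl hlt).2, N, ⟨hlt, h2, fun n hn => h3 n (by omega)⟩, hL⟩
  · rintro ⟨h0, N, ⟨h1, h2, h3⟩, hL⟩
    refine ⟨N, ⟨by omega, h2, fun n hn hN => ?_⟩, hL⟩
    rcases hn.eq_or_lt with rfl | hlt
    · exact ⟨h, h0⟩
    · exact h3 n hlt hN

/-- Factor attached to an up-step of the walk started at distance `k` from its target. -/
def upFactor (s : Bool) (q : ℕ → ℝ) (k : ℕ) : ℝ := if s then 1 else q (k + 1)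

/-- Factor attached to a down-step of the walk started at distance `k` from its target. -/
def downFactor (s : Bool) (q : ℕ → ℝ) (k : ℕ) : ℝ := if s then q k else 1

section

variable {Ω : Type*} [MeasurableSpace Ω] {P : Measure Ω} [IsProbabilityMeasure P]
  {X : Ω → TreedBridge}

/-- One step of the exploration: each move has probability 1/2, and the move along a down-step of
the bridge also pays the probability that its tree is admissible. -/
theorem IsAtom.step_treeOk (hX : IsUniformInfiniteTreedBridge P X) {q : ℕ → ℝ}
    (hq : ∀ n, 0 ≤ q n)
    (hC : ∀ t n, boltzmannMass (t + (n + 1 : ℕ)) (C t) = ENNReal.ofReal (q (n + 1)))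
    {m k : ℕ} {t : ℤ} {E : Set Ω} (hE : IsAtom X s m (t + (k + 1 : ℕ)) E) :
    (IsAtom X s (m + 1) (t + (k + 2 : ℕ))
      (E ∩ {ω | (X ω).b (pos s (m + 1)) = t + (k + 2 : ℕ)} ∩ {ω | TreeOk (X ω) s C m t}) ∧
    P.real (E ∩ {ω | (X ω).b (pos s (m + 1)) = t + (k + 2 : ℕ)} ∩ {ω | TreeOk (X ω) s C m t}) =
      upFactor s q (k + 1) / 2 * P.real E) ∧
    (IsAtom X s (m + 1) (t + k)
      (E ∩ {ω | (X ω).b (pos s (m + 1)) = t + k} ∩ {ω | TreeOk (X ω) s C m t}) ∧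
    P.real (E ∩ {ω | (X ω).b (pos s (m + 1)) = t + k} ∩ {ω | TreeOk (X ω) s C m t}) =
      downFactor s q (k + 1) / 2 * P.real E) := by
  have hno : ∀ δ : ℤ, sgn s * δ = 1 →
      E ∩ {ω | (X ω).b (pos s (m + 1)) = t + (k + 1 : ℕ) + δ} ∩ {ω | TreeOk (X ω) s C m t} =
      E ∩ {ω | (X ω).b (pos s (m + 1)) = t + (k + 1 : ℕ) + δ} := by
    intro δ hδ
    refine Set.inter_eq_left.2 fun ω hω h => absurd h ?_
    rw [mem_downSteps_edge, hω.2, hE.eq_of_mem hω.1, add_sub_cancel_left]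
    omega
  have hyes : ∀ δ : ℤ, sgn s * δ = -1 →
      E ∩ {ω | (X ω).b (pos s (m + 1)) = t + (k + 1 : ℕ) + δ} ∩ {ω | TreeOk (X ω) s C m t} =
      E ∩ {ω | (X ω).b (pos s (m + 1)) = t + (k + 1 : ℕ) + δ} ∩
        treeEvent X (edge s m) (C t) := by
    intro δ hδ
    ext ω
    refine and_congr_right fun hω => ?_
    have hd : edge s m ∈ downSteps (X ω).b := by
      rw [mem_downSteps_edge, hω.2, hE.eq_of_mem hω.1, add_sub_cancel_left, hδ]
    exact ⟨fun h => ⟨hd, h hd⟩, fun ⟨h, hh⟩ _ => hh⟩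
  have e1 : t + ((k + 2 : ℕ) : ℤ) = t + (k + 1 : ℕ) + 1 := by push_cast; ring
  have e2 : t + (k : ℤ) = t + (k + 1 : ℕ) + -1 := by push_cast; ring
  rw [e1, e2]
  cases s with
  | true =>
    have hup := hE.step hX (δ := 1) (by simp)
    have hdown := hE.step_tree hX (δ := -1) (by simp [sgn]) (C t)
    rw [hno 1 (by simp [sgn]), hyes (-1) (by simp [sgn])]
    refine ⟨⟨hup.1, ?_⟩, hdown.1, ?_⟩
    · rw [measureReal_def, hup.2]
      simp [upFactor, measureReal_def]
    · rw [measureReal_def, hdown.2, if_pos rfl, hC, ENNReal.toReal_mul, ENNReal.toReal_mul,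
        ENNReal.toReal_ofReal (hq _)]
      simp only [downFactor, if_true, measureReal_def, ENNReal.toReal_inv, ENNReal.toReal_ofNat]
      ring
  | false =>
    have hup := hE.step_tree hX (δ := 1) (by simp [sgn]) (C t)
    have hdown := hE.step hX (δ := -1) (by simp)
    rw [hno (-1) (by simp [sgn]), hyes 1 (by simp [sgn])]
    refine ⟨⟨hup.1, ?_⟩, hdown.1, ?_⟩
    · rw [measureReal_def, hup.2, if_neg (by simp), ← e1, hC, ENNReal.toReal_mul,
        ENNReal.toReal_mul, ENNReal.toReal_ofReal (hq _)]
      simp only [upFactor, Bool.false_eq_true, if_false, measureReal_def, ENNReal.toReal_inv,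
        ENNReal.toReal_ofNat]
      ring
    · rw [measureReal_def, hdown.2]
      simp [downFactor, measureReal_def]

/-- The recursion satisfied by the probability `g k` to reach a target at distance `k`. -/
structure IsReachProb (s : Bool) (C : ℤ → Set LTree) (q g : ℕ → ℝ) : Prop where
  nonneg : ∀ n, 0 ≤ q n
  le_one : ∀ n, q n ≤ 1
  mass : ∀ t n, boltzmannMass (t + (n + 1 : ℕ)) (C t) = ENNReal.ofReal (q (n + 1))
  zero : g 0 = 1
  nonneg' : ∀ n, 0 ≤ g n
  le_one' : ∀ n, g n ≤ 1
  succ : ∀ k, g (k + 1) =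
    (upFactor s q (k + 1) * g (k + 2) + downFactor s q (k + 1) * g k) / 2

/-- The true probability and g satisfy the same first-step recursion with factors at most 1. After n
steps the discrepancy is thus carried only by walks that have not yet hit the target. -/
theorem abs_measure_chain_sub_le (hX : IsUniformInfiniteTreedBridge P X) {q g : ℕ → ℝ}
    (hg : IsReachProb s C q g) {t : ℤ} {L : List ℤ} {c : ℝ} (hc0 : 0 ≤ c) (hc1 : c ≤ 1)
    (hL : ∀ m E, IsAtom X s m t E → P.real (E ∩ {ω | Chain (X ω) s C m L}) = P.real E * c)
    (n : ℕ) (k m : ℕ) (E : Set Ω) (hE : IsAtom X s m (t + k) E) :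
    |P.real (E ∩ {ω | Chain (X ω) s C m (t :: L)}) - P.real E * (g k * c)| ≤
      P.real E * survival n k := by
  have hzero : ∀ m E, IsAtom X s m t E →
      P.real (E ∩ {ω | Chain (X ω) s C m (t :: L)}) = P.real E * (g 0 * c) := by
    intro m E hE
    rw [hg.zero, one_mul, ← hL m E hE]
    congr 1
    ext ω
    exact and_congr_right fun hω => chain_cons_of_eq (hE.eq_of_mem hω)
  have hgc : ∀ k, 0 ≤ g k * c ∧ g k * c ≤ 1 := fun k =>
    ⟨mul_nonneg (hg.nonneg' k) hc0, mul_le_one₀ (hg.le_one' k) hc0 hc1⟩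
  induction n generalizing k m E with
  | zero =>
    rcases k with _ | k
    · rw [hzero m E (by simpa using hE), sub_self, abs_zero]
      exact mul_nonneg measureReal_nonneg (survival_nonneg _ _)
    · rw [survival, mul_one]
      have h1 : P.real (E ∩ {ω | Chain (X ω) s C m (t :: L)}) ≤ P.real E :=
        measureReal_mono Set.inter_subset_left
      have h2 : 0 ≤ P.real (E ∩ {ω | Chain (X ω) s C m (t :: L)}) := measureReal_nonneg
      have h3 : 0 ≤ P.real E := measureReal_nonneg
      have h4 := hgc (k + 1)
      rw [abs_le]
      constructor <;> nlinarith [h4.1, h4.2]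
  | succ n ih =>
    rcases k with _ | k
    · rw [hzero m E (by simpa using hE), sub_self, abs_zero]
      exact mul_nonneg measureReal_nonneg (survival_nonneg _ _)
    · obtain ⟨⟨hu, hPu⟩, hd, hPd⟩ := hE.step_treeOk hX hg.nonneg hg.mass
      have iu := ih _ _ _ hu
      have idn := ih _ _ _ hd
      set Eu := E ∩ {ω | (X ω).b (pos s (m + 1)) = t + (k + 2 : ℕ)} ∩ {ω | TreeOk (X ω) s C m t}
      set Ed := E ∩ {ω | (X ω).b (pos s (m + 1)) = t + k} ∩ {ω | TreeOk (X ω) s C m t}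
      have hsplit : P.real (E ∩ {ω | Chain (X ω) s C m (t :: L)}) =
          P.real (Eu ∩ {ω | Chain (X ω) s C (m + 1) (t :: L)}) +
          P.real (Ed ∩ {ω | Chain (X ω) s C (m + 1) (t :: L)}) := by
        have hmeas : MeasurableSet {ω | (X ω).b (pos s (m + 1)) = t + (k + 2 : ℕ)} :=
          hX.measurable_bridge _ (measurableSet_singleton _)
        rw [← measureReal_inter_add_sdiff (s := E ∩ {ω | Chain (X ω) s C m (t :: L)}) hmeas]
        have hlt : ∀ ω ∈ E, t < (X ω).b (pos s m) := fun ω hω => by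
          rw [hE.eq_of_mem hω]; omega
        have hstep : ∀ ω ∈ E, (X ω).b (pos s (m + 1)) = t + (k + 2 : ℕ) ∨
            (X ω).b (pos s (m + 1)) = t + k := fun ω hω => by
          have h1 := (X ω).abs_step (edge s m)
          have h2 := hE.eq_of_mem hω
          rw [step_edge, h2] at h1
          rcases (abs_eq zero_le_one).1 h1 with h | h <;> cases s <;>
            simp only [sgn, if_true, if_false, Bool.false_eq_true] at h <;> omega
        congr 2
        · ext ω
          simp only [Eu, Set.mem_inter_iff, Set.mem_ofPred_eq]
          constructor
          · rintro ⟨⟨h1, h2⟩, h3⟩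
            rw [chain_cons_of_lt (hlt ω h1)] at h2
            exact ⟨⟨⟨h1, h3⟩, h2.1⟩, h2.2⟩
          · rintro ⟨⟨⟨h1, h3⟩, h4⟩, h5⟩
            exact ⟨⟨h1, (chain_cons_of_lt (hlt ω h1)).2 ⟨h4, h5⟩⟩, h3⟩
        · ext ω
          simp only [Ed, Set.mem_inter_iff, Set.mem_sdiff, Set.mem_ofPred_eq]
          constructor
          · rintro ⟨⟨h1, h2⟩, h3⟩
            rw [chain_cons_of_lt (hlt ω h1)] at h2
            exact ⟨⟨⟨h1, (hstep ω h1).resolve_left h3⟩, h2.1⟩, h2.2⟩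
          · rintro ⟨⟨⟨h1, h3⟩, h4⟩, h5⟩
            exact ⟨⟨h1, (chain_cons_of_lt (hlt ω h1)).2 ⟨h4, h5⟩⟩, by omega⟩
      rw [hsplit, survival]
      have hE0 : 0 ≤ P.real E := measureReal_nonneg
      have hsu := survival_nonneg n (k + 2)
      have hsd := survival_nonneg n k
      have au : 0 ≤ upFactor s q (k + 1) ∧ upFactor s q (k + 1) ≤ 1 := by
        cases s <;> simp [upFactor, hg.nonneg, hg.le_one]
      have ad : 0 ≤ downFactor s q (k + 1) ∧ downFactor s q (k + 1) ≤ 1 := by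
        cases s <;> simp [downFactor, hg.nonneg, hg.le_one]
      rw [hPu] at iu
      rw [hPd] at idn
      have bu : upFactor s q (k + 1) / 2 * P.real E * survival n (k + 2) ≤
          P.real E * survival n (k + 2) / 2 := by
        have := mul_nonneg hE0 hsu
        nlinarith [au.2]
      have bd : downFactor s q (k + 1) / 2 * P.real E * survival n k ≤
          P.real E * survival n k / 2 := by
        have := mul_nonneg hE0 hsd
        nlinarith [ad.2]
      have hrec : P.real E * (g (k + 1) * c) =
          upFactor s q (k + 1) / 2 * P.real E * (g (k + 2) * c) +
          downFactor s q (k + 1) / 2 * P.real E * (g k * c) := by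
        rw [hg.succ]; ring
      rw [hrec, abs_le]
      obtain ⟨iu1, iu2⟩ := abs_le.1 iu
      obtain ⟨id1, id2⟩ := abs_le.1 idn
      constructor <;> linarith

/-- Product of the probabilities of the successive gaps. -/
noncomputable def gapProd (g : ℕ → ℝ) : ℤ → List ℤ → ℝ
  | _, [] => 1
  | x, t :: L => g (x - t).toNat * gapProd g t L

theorem gapProd_mem {q g : ℕ → ℝ} (hg : IsReachProb s C q g) (x : ℤ) (L : List ℤ) :
    0 ≤ gapProd g x L ∧ gapProd g x L ≤ 1 := by
  induction L generalizing x with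
  | nil => simp [gapProd]
  | cons t L ih =>
    exact ⟨mul_nonneg (hg.nonneg' _) (ih t).1, mul_le_one₀ (hg.le_one' _) (ih t).1 (ih t).2⟩

/-- The end of one passage is again an atom, so the rest of the list contributes an independent
factor; letting n tend to infinity removes the error. -/
theorem measure_chain (hX : IsUniformInfiniteTreedBridge P X) {q g : ℕ → ℝ}
    (hg : IsReachProb s C q g) (L : List ℤ) {x : ℤ} (hx : List.IsChain (· ≥ ·) (x :: L)) {m : ℕ}
    {E : Set Ω} (hE : IsAtom X s m x E) :
    P.real (E ∩ {ω | Chain (X ω) s C m L}) = P.real E * gapProd g x L := by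
  induction L generalizing x m E with
  | nil => simp [Chain, gapProd]
  | cons t L ih =>
    rw [List.isChain_cons_cons] at hx
    obtain ⟨k, rfl⟩ : ∃ k : ℕ, x = t + k := ⟨(x - t).toNat, by omega⟩
    have key := fun n => abs_measure_chain_sub_le hX hg (gapProd_mem hg t L).1
      (gapProd_mem hg t L).2 (fun m E hE => ih hx.2 hE) n k m E hE
    have hlim := (tendsto_survival k).const_mul (P.real E)
    rw [mul_zero] at hlim
    have h0 := ge_of_tendsto' hlim key
    rw [gapProd, add_sub_cancel_left, Int.toNat_natCast]
    exact sub_eq_zero.1 (abs_nonpos_iff.1 h0)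

end

theorem isReachProb_right : IsReachProb true (fun t => {τ | τ.All (t < ·)})
    (fun n => posProb n) (fun n => 1 / ((n : ℝ) + 1)) where
  nonneg := posProb_nonneg
  le_one := posProb_le_one
  mass := boltzmannMass_gt
  zero := by simp
  nonneg' n := by positivity
  le_one' n := by rw [div_le_one (by positivity)]; linarith [(n.cast_nonneg : (0 : ℝ) ≤ n)]
  succ k := by
    simp only [upFactor, downFactor, posProb, if_true]
    push_cast
    field_simp
    ring

theorem isReachProb_left : IsReachProb false (fun t => {τ | τ.All (t < ·)})
    (fun n => posProb n) (fun n => 3 / ((n : ℝ) + 3)) where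
  nonneg := posProb_nonneg
  le_one := posProb_le_one
  mass := boltzmannMass_gt
  zero := by simp
  nonneg' n := by positivity
  le_one' n := by rw [div_le_one (by positivity)]; linarith [(n.cast_nonneg : (0 : ℝ) ≤ n)]
  succ k := by
    simp only [upFactor, downFactor, posProb, Bool.false_eq_true, if_false]
    push_cast
    field_simp
    ring

theorem isReachProb_univ : IsReachProb s (fun _ => Set.univ) (fun _ => 1) (fun _ => 1) where
  nonneg _ := zero_le_one
  le_one _ := le_rfl
  mass t n := by rw [boltzmannMass_univ, ENNReal.ofReal_one]
  zero := rfl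
  nonneg' _ := zero_le_one
  le_one' _ := le_rfl
  succ k := by cases s <;> simp [upFactor, downFactor]

/-- With no constraint on the trees, the constant 1 solves the recursion, so every negative level is
reached on the right. -/
theorem ae_exists_eq_neg {Ω : Type*} [MeasurableSpace Ω] {P : Measure Ω} [IsProbabilityMeasure P]
    {X : Ω → TreedBridge} (hX : IsUniformInfiniteTreedBridge P X) :
    ∀ᵐ ω ∂P, ∀ j : ℕ, ∃ n : ℕ, (X ω).b n = -j := by
  rw [ae_all_iff]
  intro j
  have h := measure_chain hX (s := true) isReachProb_univ [-(j : ℤ)] (x := 0) (by simp)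
    (isAtom_univ X true)
  have hmeas : MeasurableSet {ω | ∃ n : ℕ, (X ω).b n = -j} := by
    have : {ω | ∃ n : ℕ, (X ω).b n = -j} = ⋃ n : ℕ, (fun ω => (X ω).b n) ⁻¹' {-(j : ℤ)} := by
      ext ω; simp
    rw [this]
    exact MeasurableSet.iUnion fun n => hX.measurable_bridge _ (measurableSet_singleton _)
  have h1 : P {ω | ∃ n : ℕ, (X ω).b n = -j} = 1 := by
    refine le_antisymm prob_le_one ?_
    have h2 : P.real (Set.univ ∩ {ω | Chain (X ω) true (fun _ => Set.univ) 0 [-(j : ℤ)]}) = 1 := by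
      rw [h]; simp [gapProd]
    rw [measureReal_def, ENNReal.toReal_eq_one_iff] at h2
    rw [← h2]
    refine measure_mono ?_
    rintro ω ⟨-, N, ⟨-, hN, -⟩, -⟩
    exact ⟨N, by simpa [pos] using hN⟩
  exact (mem_ae_iff_prob_eq_one₀ hmeas.nullMeasurableSet).2 h1

end UIHPQ

/-! ### Labels along the contour of a tree -/

namespace UIHPQ

/-- The contour moves along edges, so a label drops by at most one between consecutive corners, and
the exploration ends back at the parent. -/
theorem LForest.isChain_contour (F : LForest) (u₀ u : List ℕ) (p : ℤ) (k : ℕ)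
    (hF : F.WellLabeled p) :
    List.IsChain (fun a b : List ℕ × ℤ => a.2 - 1 ≤ b.2) ((u₀, p) :: F.contour u p k) ∧
      ∀ x ∈ ((u₀, p) :: F.contour u p k).getLast?, x.2 = p := by
  induction F generalizing u₀ u p k with
  | nil => simp [LForest.contour]
  | cons ℓ s r hs hr =>
    obtain ⟨h1, h2, h3⟩ := hF
    rw [abs_le] at h1
    obtain ⟨s1, s2⟩ := hs (u ++ [k]) (u ++ [k]) ℓ 0 h2
    obtain ⟨r1, r2⟩ := hr u u p (k + 1) h3
    rw [LForest.contour, ← List.cons_append]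
    refine ⟨List.IsChain.cons (List.isChain_append.2 ⟨s1, r1, ?_⟩) ?_, ?_⟩
    · intro x hx y hy
      simp only [List.head?_cons, Option.mem_some_iff] at hy
      rw [s2 x hx, ← hy]
      simp only
      omega
    · intro y hy
      simp only [List.cons_append, List.head?_cons, Option.mem_some_iff] at hy
      rw [← hy]
      simp only
      omega
    · intro x hx
      apply r2 x
      simpa [List.getLast?_cons, List.getLast?_append] using hx

theorem LForest.all_of_contour {Q : ℤ → Prop} (F : LForest) (u : List ℕ) (p : ℤ) (k : ℕ)
    (h : ∀ c ∈ F.contour u p k, Q c.2) : F.All Q := by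
  induction F generalizing u p k with
  | nil => trivial
  | cons ℓ s r hs hr =>
    simp only [LForest.contour, List.mem_cons, List.mem_append] at h
    exact ⟨h _ (Or.inl rfl), hs _ _ _ fun c hc => h c (Or.inr (Or.inl hc)),
      hr _ _ _ fun c hc => h c (Or.inr (Or.inr (Or.inr hc)))⟩

theorem LForest.All.contour {Q : ℤ → Prop} {F : LForest} (h : F.All Q) (u : List ℕ) {p : ℤ}
    (k : ℕ) (hp : Q p) : ∀ c ∈ F.contour u p k, Q c.2 := by
  induction F generalizing u p k with
  | nil => simp [LForest.contour]
  | cons ℓ s r hs hr =>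
    obtain ⟨h1, h2, h3⟩ := h
    simp only [LForest.contour, List.mem_cons, List.mem_append]
    rintro c (rfl | hc | rfl | hc)
    · exact h1
    · exact hs h2 _ _ h1 c hc
    · exact hp
    · exact hr h3 _ _ hp c hc

theorem LTree.all_iff {Q : ℤ → Prop} (τ : LTree) : τ.All Q ↔ ∀ c ∈ τ.contour, Q c.2 := by
  rw [LTree.contour, List.forall_mem_cons]
  exact ⟨fun h => ⟨h.1, h.2.contour _ _ h.1⟩, fun h => ⟨h.1, τ.sub.all_of_contour _ _ _ h.2⟩⟩

/-- The label of the vertex with a given address, in the forest hanging as children number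
`k`, `k + 1`, ... from a vertex with label `p`. -/
def LForest.labelAt : LForest → ℤ → ℕ → List ℕ → ℤ
  | _, p, _, [] => p
  | .nil, _, _, _ :: _ => 0
  | .cons ℓ sub rest, p, k, i :: a =>
      if i = k then sub.labelAt ℓ 0 a else rest.labelAt p (k + 1) (i :: a)

theorem LForest.labelAt_nil (F : LForest) (p : ℤ) (k : ℕ) : F.labelAt p k [] = p := by
  cases F <;> simp [LForest.labelAt]

/-- The label depends on the address alone, so corners of one vertex share their label. The bound on
the first letter of the address separates the first tree from the later ones. -/
theorem LForest.label_eq (F : LForest) (u : List ℕ) (p : ℤ) (k : ℕ) :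
    ∀ c ∈ F.contour u p k, ∃ a, c.1 = u ++ a ∧ c.2 = F.labelAt p k a ∧ ∀ i ∈ a.head?, k ≤ i := by
  induction F generalizing u p k with
  | nil => simp [LForest.contour]
  | cons ℓ s r hs hr =>
    simp only [LForest.contour, List.mem_cons, List.mem_append]
    rintro c (rfl | hc | rfl | hc)
    · exact ⟨[k], rfl, by simp [LForest.labelAt, LForest.labelAt_nil], by simp⟩
    · obtain ⟨a, h1, h2, -⟩ := hs _ _ _ c hc
      exact ⟨k :: a, by simp [h1], by simp [LForest.labelAt, h2], by simp⟩
    · exact ⟨[], by simp, by simp [LForest.labelAt], by simp⟩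
    · obtain ⟨a, h1, h2, h3⟩ := hr _ _ _ c hc
      refine ⟨a, h1, ?_, fun i hi => (Nat.le_succ k).trans (h3 i hi)⟩
      rcases a with _ | ⟨i, a⟩
      · rw [h2, LForest.labelAt_nil, LForest.labelAt_nil]
      · have : i ≠ k := by
          have := h3 i (by simp)
          omega
        rw [h2, LForest.labelAt, if_neg this]

def LTree.labelAt (τ : LTree) (a : List ℕ) : ℤ := τ.sub.labelAt τ.label 0 a

theorem LTree.label_eq (τ : LTree) {c : List ℕ × ℤ} (hc : c ∈ τ.contour) :
    c.2 = τ.labelAt c.1 := by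
  rcases List.mem_cons.1 hc with rfl | hc
  · simp [LTree.labelAt, LForest.labelAt_nil]
  · obtain ⟨a, h1, h2, -⟩ := τ.sub.label_eq _ _ _ c hc
    rw [h2, h1]
    rfl

theorem exists_eq_of_lt {f : ℕ → ℤ} (hf : ∀ n, |f (n + 1) - f n| = 1) {ℓ : ℤ} (h0 : ℓ ≤ f 0)
    {n : ℕ} (hn : f n < ℓ) : ∃ k < n, f k = ℓ ∧ f (k + 1) = ℓ - 1 := by
  induction n with
  | zero => omega
  | succ n ih =>
    rcases lt_or_ge (f n) ℓ with h | h
    · obtain ⟨k, hk, h⟩ := ih h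
      exact ⟨k, by omega, h⟩
    · refine ⟨n, by omega, ?_⟩
      rcases (abs_eq zero_le_one).1 (hf n) with h' | h' <;> omega

theorem exists_first_eq {f : ℕ → ℤ} (hf : ∀ n, |f (n + 1) - f n| = 1) {ℓ : ℤ} (h0 : ℓ ≤ f 0)
    {n : ℕ} (hn : f n = ℓ) : ∃ N ≤ n, f N = ℓ ∧ ∀ k < N, ℓ < f k := by
  classical
  have hex : ∃ n, f n = ℓ := ⟨n, hn⟩
  refine ⟨Nat.find hex, Nat.find_min' hex hn, Nat.find_spec hex, fun k hk => ?_⟩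
  by_contra hle
  have hne : f k ≠ ℓ := Nat.find_min hex hk
  obtain ⟨k', hk', h, -⟩ := exists_eq_of_lt hf h0 (n := k) (by omega)
  exact Nat.find_min hex (hk'.trans hk) h

/-! ### Corners, successors and the maximal geodesic -/

namespace TreedBridge

variable {Y : TreedBridge}

theorem abs_step_pos (Y : TreedBridge) (s : Bool) (n : ℕ) :
    |Y.b (pos s (n + 1)) - Y.b (pos s n)| = 1 := by
  have := Y.abs_step (edge s n)
  rw [step_edge] at this
  cases s <;> simpa [sgn, abs_sub_comm] using this

theorem exists_downStep {i k ℓ : ℤ} (hik : i ≤ k) (hi : ℓ ≤ Y.b i) (hk : Y.b k < ℓ) :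
    ∃ n, i ≤ n ∧ n < k ∧ Y.b n = ℓ ∧ n ∈ downSteps Y.b := by
  obtain ⟨m, rfl⟩ : ∃ m : ℕ, k = i + m := ⟨(k - i).toNat, by omega⟩
  obtain ⟨n, hn, h1, h2⟩ := exists_eq_of_lt (f := fun n : ℕ => Y.b (i + n))
    (fun n => by have := Y.abs_step (i + n); push_cast; rwa [← add_assoc]) (by simpa using hi) hk
  refine ⟨i + n, by omega, by omega, h1, ?_⟩
  push_cast at h2
  rw [← add_assoc] at h2
  rw [downSteps, Set.mem_ofPred_eq, h2, h1]

/-- The position of a corner in the contour of its tree. -/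
def cornerPos (c : Y.Corner) : ℕ := (ofLex c).2

theorem cornerIndex_mem (c : Y.Corner) : Y.cornerIndex c ∈ downSteps Y.b := (ofLex c).1.2

theorem corner_lt_iff {c c' : Y.Corner} : c < c' ↔ Y.cornerIndex c < Y.cornerIndex c' ∨
    Y.cornerIndex c = Y.cornerIndex c' ∧ cornerPos c < cornerPos c' := by
  obtain ⟨⟨i, hi⟩, p⟩ := c
  obtain ⟨⟨i', hi'⟩, p'⟩ := c'
  refine Iff.trans Sigma.Lex.lt_def ?_
  constructor
  · rintro (h | ⟨h, h'⟩)
    · exact Or.inl h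
    · cases h
      exact Or.inr ⟨rfl, h'⟩
  · rintro (h | ⟨h, h'⟩)
    · exact Or.inl h
    · cases h
      exact Or.inr ⟨rfl, h'⟩

theorem corner_ext {c c' : Y.Corner} (h : Y.cornerIndex c = Y.cornerIndex c')
    (h' : cornerPos c = cornerPos c') : c = c' := by
  refine le_antisymm (not_lt.1 fun hlt => ?_) (not_lt.1 fun hlt => ?_) <;>
    rw [corner_lt_iff] at hlt <;> omega

theorem cornerIndex_mono {c c' : Y.Corner} (h : c ≤ c') : Y.cornerIndex c ≤ Y.cornerIndex c' := by
  by_contra hlt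
  exact absurd (corner_lt_iff.2 (Or.inl (not_le.1 hlt))) (not_lt.2 h)

theorem exists_corner {i : ℤ} (hi : i ∈ downSteps Y.b) {p : ℕ}
    (hp : p < (Y.T ⟨i, hi⟩).contour.length) :
    ∃ c : Y.Corner, Y.cornerIndex c = i ∧ cornerPos c = p ∧
      Y.cornerLabel c = (Y.T ⟨i, hi⟩).contour[p].2 ∧
      Y.cornerVertex c = (i, (Y.T ⟨i, hi⟩).contour[p].1) :=
  ⟨toLex ⟨⟨i, hi⟩, ⟨p, hp⟩⟩, rfl, rfl, rfl, rfl⟩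

theorem exists_first_corner {i : ℤ} (hi : i ∈ downSteps Y.b) :
    ∃ c : Y.Corner, Y.cornerIndex c = i ∧ cornerPos c = 0 ∧ Y.cornerLabel c = Y.b i ∧
      Y.cornerVertex c = (i, []) := by
  obtain ⟨c, h1, h2, h3, h4⟩ := exists_corner hi (p := 0) (by simp [LTree.contour])
  refine ⟨c, h1, h2, ?_, ?_⟩
  · rw [h3]
    simp [LTree.contour, Y.label_T]
  · rw [h4]
    simp [LTree.contour]

theorem cornerLabel_of_pos_eq_zero {c : Y.Corner} (h : cornerPos c = 0) :
    Y.cornerLabel c = Y.b (Y.cornerIndex c) := by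
  obtain ⟨c', h1, h2, h3, -⟩ := exists_first_corner (cornerIndex_mem c)
  rw [← h3, corner_ext h1 (h2.trans h.symm)]

theorem isChain_contour (Y : TreedBridge) (i : downSteps Y.b) :
    List.IsChain (fun a b : List ℕ × ℤ => a.2 - 1 ≤ b.2) (Y.T i).contour ∧
      ∀ x ∈ (Y.T i).contour.getLast?, x.2 = Y.b i := by
  obtain ⟨h1, h2⟩ := (Y.T i).sub.isChain_contour [] [] (Y.T i).label 0 (Y.wellLabeled_T i)
  exact ⟨h1, fun x hx => (h2 x hx).trans (Y.label_T i)⟩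

theorem exists_last_corner (c : Y.Corner) :
    ∃ c' : Y.Corner, c ≤ c' ∧ Y.cornerIndex c' = Y.cornerIndex c ∧
      Y.cornerLabel c' = Y.b (Y.cornerIndex c) := by
  have hlen : 0 < (Y.T ⟨_, cornerIndex_mem c⟩).contour.length := by simp [LTree.contour]
  obtain ⟨c', h1, h2, h3, -⟩ := exists_corner (cornerIndex_mem c)
    (p := (Y.T ⟨_, cornerIndex_mem c⟩).contour.length - 1) (by omega)
  refine ⟨c', not_lt.1 fun hlt => ?_, h1, ?_⟩
  · have : cornerPos c < (Y.T ⟨_, cornerIndex_mem c⟩).contour.length := (ofLex c).2.2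
    rw [corner_lt_iff] at hlt
    omega
  · rw [h3]
    apply (Y.isChain_contour ⟨_, cornerIndex_mem c⟩).2
    rw [List.getLast?_eq_getElem?]
    simp

theorem exists_prev_corner {c : Y.Corner} (h : cornerPos c ≠ 0) :
    ∃ c' : Y.Corner, Y.cornerIndex c' = Y.cornerIndex c ∧ cornerPos c' + 1 = cornerPos c ∧
      Y.cornerLabel c' - 1 ≤ Y.cornerLabel c := by
  have hlt : cornerPos c < (Y.T ⟨_, cornerIndex_mem c⟩).contour.length := (ofLex c).2.2
  obtain ⟨q, hq⟩ := Nat.exists_eq_succ_of_ne_zero h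
  obtain ⟨c', h1, h2, h3, -⟩ := exists_corner (cornerIndex_mem c) (p := q) (by omega)
  refine ⟨c', h1, by omega, ?_⟩
  have hc : Y.cornerLabel c = (Y.T ⟨_, cornerIndex_mem c⟩).contour[q + 1].2 := by
    change (Y.T ⟨_, cornerIndex_mem c⟩).contour[cornerPos c].2 = _
    congr 2
  rw [h3, hc]
  exact (List.isChain_iff_getElem.1 (Y.isChain_contour ⟨_, cornerIndex_mem c⟩).1) q (by omega)

theorem tree_all_iff {i : ℤ} (hi : i ∈ downSteps Y.b) {Q : ℤ → Prop} :
    (Y.T ⟨i, hi⟩).All Q ↔ ∀ c : Y.Corner, Y.cornerIndex c = i → Q (Y.cornerLabel c) := by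
  rw [LTree.all_iff]
  constructor
  · rintro h c rfl
    exact h _ (List.get_mem _ _)
  · intro h a ha
    obtain ⟨p, hp, rfl⟩ := List.getElem_of_mem ha
    obtain ⟨c, h1, -, h3, -⟩ := exists_corner hi hp
    rw [← h3]
    exact h c h1

open Classical in
/-- The label of a vertex. -/
noncomputable def vertexLabel (Y : TreedBridge) (v : Vertex) : ℤ :=
  if h : v.1 ∈ downSteps Y.b then (Y.T ⟨v.1, h⟩).labelAt v.2 else 0

theorem vertexLabel_cornerVertex (c : Y.Corner) :
    Y.vertexLabel (Y.cornerVertex c) = Y.cornerLabel c := by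
  have h : (Y.cornerVertex c).1 ∈ downSteps Y.b := cornerIndex_mem c
  rw [vertexLabel, dif_pos h]
  exact (LTree.label_eq _ (List.get_mem _ _)).symm

theorem cornerLabel_eq {c c' : Y.Corner} (h : Y.cornerVertex c = Y.cornerVertex c') :
    Y.cornerLabel c = Y.cornerLabel c' := by
  rw [← vertexLabel_cornerVertex, h, vertexLabel_cornerVertex]

theorem cornerIndex_eq {c c' : Y.Corner} (h : Y.cornerVertex c = Y.cornerVertex c') :
    Y.cornerIndex c = Y.cornerIndex c' := congrArg Prod.fst h

/-- To the right of a fixed integer the corner order is well founded, since it embeds in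
lexicographic pairs of natural numbers. -/
theorem exists_isLeast {S : Set Y.Corner} (hS : S.Nonempty) (n : ℤ)
    (hn : ∀ c ∈ S, n ≤ Y.cornerIndex c) : ∃ c, IsLeast S c := by
  obtain ⟨c, hc, hmin⟩ := (InvImage.wf (fun c : Y.Corner =>
    (toLex ((Y.cornerIndex c - n).toNat, cornerPos c) : ℕ ×ₗ ℕ)) wellFounded_lt).has_min S hS
  refine ⟨c, hc, fun x hx => not_lt.1 fun hlt => hmin x hx ?_⟩
  have h1 := hn c hc
  have h2 := hn x hx
  simp only [InvImage, Prod.Lex.toLex_lt_toLex]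
  rcases corner_lt_iff.1 hlt with h | ⟨h, h'⟩
  · left; omega
  · right; exact ⟨by omega, h'⟩

/-- The corner `c` is the first corner to the right of `i` that has label `ℓ`. -/
def IsFirst (Y : TreedBridge) (i ℓ : ℤ) (c : Y.Corner) : Prop :=
  IsLeast {c | i ≤ Y.cornerIndex c ∧ Y.cornerLabel c = ℓ} c

/-- Labels cannot jump below ℓ. Take the first corner with label at most ℓ: if its label were
smaller, either the preceding corner of its tree or the root of an earlier down-step of the bridge
would already qualify. -/
theorem exists_corner_eq_of_le {i ℓ : ℤ} (hi : ℓ ≤ Y.b i) {c : Y.Corner}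
    (hc : i ≤ Y.cornerIndex c) (hl : Y.cornerLabel c ≤ ℓ) :
    ∃ c' ≤ c, i ≤ Y.cornerIndex c' ∧ Y.cornerLabel c' = ℓ := by
  obtain ⟨d, ⟨hd1, hd2⟩, hdmin⟩ := exists_isLeast
    (S := {c : Y.Corner | i ≤ Y.cornerIndex c ∧ Y.cornerLabel c ≤ ℓ}) ⟨c, hc, hl⟩ i fun c h => h.1
  refine ⟨d, hdmin ⟨hc, hl⟩, hd1, le_antisymm hd2 ?_⟩
  by_contra hlt
  by_cases hp : cornerPos d = 0
  · rw [cornerLabel_of_pos_eq_zero hp] at hlt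
    obtain ⟨n, h1, h2, h3, h4⟩ := exists_downStep hd1 hi (not_le.1 hlt)
    obtain ⟨e, e1, e2, e3, -⟩ := exists_first_corner h4
    have := cornerIndex_mono (hdmin (show e ∈ _ from ⟨by omega, by omega⟩))
    omega
  · obtain ⟨e, e1, e2, e3⟩ := exists_prev_corner hp
    have := hdmin (show e ∈ _ from ⟨by omega, by omega⟩)
    exact absurd (corner_lt_iff.2 (Or.inr ⟨e1, by omega⟩)) (not_lt.2 this)

/-- Same argument started at a corner inside a tree. The last corner of that tree carries the bridge
value again, which handles the passage to later trees. -/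
theorem exists_corner_succ {c c' : Y.Corner} (hcc : c < c')
    (hl : Y.cornerLabel c' ≤ Y.cornerLabel c - 1) :
    ∃ d, c < d ∧ Y.cornerLabel d = Y.cornerLabel c - 1 := by
  obtain ⟨d, ⟨hd1, hd2⟩, hdmin⟩ := exists_isLeast
    (S := {d : Y.Corner | c < d ∧ Y.cornerLabel d ≤ Y.cornerLabel c - 1}) ⟨c', hcc, hl⟩
    (Y.cornerIndex c) fun c h => cornerIndex_mono h.1.le
  refine ⟨d, hd1, le_antisymm hd2 ?_⟩
  by_contra hlt
  by_cases hp : cornerPos d = 0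
  · rw [cornerLabel_of_pos_eq_zero hp] at hlt
    obtain ⟨e, e1, e2, e3⟩ := exists_last_corner c
    have hidx : Y.cornerIndex c < Y.cornerIndex d := by
      rcases corner_lt_iff.1 hd1 with h | ⟨-, h⟩ <;> omega
    have hed : e < d := corner_lt_iff.2 (Or.inl (by omega))
    rcases lt_or_ge (Y.cornerLabel c - 1) (Y.b (Y.cornerIndex c)) with hb | hb
    · obtain ⟨n, h1, h2, h3, h4⟩ := exists_downStep hidx.le hb.le (not_le.1 hlt)
      obtain ⟨f, f1, f2, f3, -⟩ := exists_first_corner h4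
      have hn : Y.cornerIndex c ≠ n := fun h => by rw [h] at hb; omega
      have := cornerIndex_mono (hdmin (show f ∈ _ from
        ⟨corner_lt_iff.2 (Or.inl (by omega)), by omega⟩))
      omega
    · have hne : c ≠ e := fun h => by rw [← h] at e3; omega
      have := hdmin (show e ∈ _ from ⟨lt_of_le_of_ne e1 hne, by omega⟩)
      exact absurd hed (not_lt.2 this)
  · obtain ⟨e, e1, e2, e3⟩ := exists_prev_corner hp
    have hed : e < d := corner_lt_iff.2 (Or.inr ⟨e1, by omega⟩)
    rcases lt_or_eq_of_le (show c ≤ e from not_lt.1 fun h => by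
      rw [corner_lt_iff] at h hd1; omega) with h | rfl
    · exact absurd hed (not_lt.2 (hdmin ⟨h, by omega⟩))
    · omega

theorem exists_lt
    (hY : ∀ j : ℕ, ∃ n : ℕ, Y.b n = -j) (i ℓ : ℤ) : ∃ k, i ≤ k ∧ Y.b k < ℓ := by
  -- The walk loses at most one per step, so a value as low as -i cannot be attained before time i.
  obtain ⟨n, hn⟩ := hY (max i (1 - ℓ)).toNat
  have hlow : ∀ n : ℕ, -(n : ℤ) ≤ Y.b n := by
    intro n
    induction n with
    | zero => simp [Y.b_zero]
    | succ n ih =>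
      have := (abs_le.1 (Y.abs_step n).le).1
      push_cast
      linarith
  have := hlow n
  exact ⟨n, by omega, by omega⟩

theorem exists_isFirst
    (hY : ∀ j : ℕ, ∃ n : ℕ, Y.b n = -j) {i ℓ : ℤ} (h : ℓ ≤ Y.b i) : ∃ c, Y.IsFirst i ℓ c := by
  obtain ⟨k, hk, hk'⟩ := exists_lt hY i ℓ
  obtain ⟨n, h1, -, h3, h4⟩ := exists_downStep hk h hk'
  obtain ⟨c, c1, -, c3, -⟩ := exists_first_corner h4
  exact exists_isLeast ⟨c, by rwa [c1], by rw [c3, h3]⟩ i fun c h => h.1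

theorem isLeast_succ
    (hY : ∀ j : ℕ, ∃ n : ℕ, Y.b n = -j) (c : Y.Corner) :
    IsLeast {c' | c < c' ∧ Y.cornerLabel c' = Y.cornerLabel c - 1} (Y.succ c) := by
  have hex : ∃ c', IsLeast {c' | c < c' ∧ Y.cornerLabel c' = Y.cornerLabel c - 1} c' := by
    -- A down-step from this level, right of the tree of c, has a root label at most the one sought.
    set m := min (Y.cornerLabel c - 1) (Y.b (Y.cornerIndex c + 1))
    obtain ⟨k, hk, hk'⟩ := exists_lt hY (Y.cornerIndex c + 1) m
    obtain ⟨n, h1, -, h3, h4⟩ := exists_downStep hk (min_le_right _ _) hk'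
    obtain ⟨e, e1, -, e3, -⟩ := exists_first_corner h4
    obtain ⟨d, hd⟩ := exists_corner_succ (c := c) (c' := e)
      (corner_lt_iff.2 (Or.inl (by omega))) (by rw [e3, h3]; exact min_le_left _ _)
    exact exists_isLeast ⟨d, hd⟩ (Y.cornerIndex c) fun c h => cornerIndex_mono h.1.le
  rw [succ, dif_pos hex]
  exact hex.choose_spec

/-- All corners of the vertex lie in the same tree and share its label, so they compete in the same
minimum. Thus a first corner is the leftmost corner of its vertex. -/
theorem IsFirst.isLeast_vertex {i ℓ : ℤ} {c : Y.Corner} (hc : Y.IsFirst i ℓ c) :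
    IsLeast {c' | Y.cornerVertex c' = Y.cornerVertex c} c :=
  ⟨rfl, fun _ hd => hc.2 ⟨(cornerIndex_eq hd).symm ▸ hc.1.1, (cornerLabel_eq hd).trans hc.1.2⟩⟩

/-- Uniform description of both cases of `φ`: at a down-step, the first corner with label b(i) is
the root corner of the tree at i itself. -/
theorem IsFirst.boundaryMap_eq {i : ℤ} {c : Y.Corner} (hc : Y.IsFirst i (Y.b i) c) :
    Y.boundaryMap i = Y.cornerVertex c := by
  by_cases hi : i ∈ downSteps Y.b
  · rw [boundaryMap, if_pos hi]
    obtain ⟨d, d1, d2, d3, d4⟩ := exists_first_corner hi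
    rw [← d4]
    congr 1
    refine le_antisymm (not_lt.1 fun h => ?_) (hc.2 ⟨d1.ge, d3⟩)
    have := hc.1.1
    rw [corner_lt_iff] at h
    omega
  · have hset : {c : Y.Corner | i < Y.cornerIndex c ∧ Y.cornerLabel c = Y.b i} =
        {c | i ≤ Y.cornerIndex c ∧ Y.cornerLabel c = Y.b i} := by
      ext d
      refine and_congr_left fun _ => ⟨le_of_lt, fun h => lt_of_le_of_ne h ?_⟩
      rintro rfl
      exact hi (cornerIndex_mem d)
    have hc' : IsLeast {c : Y.Corner | i < Y.cornerIndex c ∧ Y.cornerLabel c = Y.b i} c := by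
      rw [hset]; exact hc
    have hex : ∃ c, IsLeast {c : Y.Corner | i < Y.cornerIndex c ∧ Y.cornerLabel c = Y.b i} c :=
      ⟨c, hc'⟩
    rw [boundaryMap, if_neg hi, dif_pos hex, hex.choose_spec.unique hc']

/-- Starting from label 0, no corner to the right of 0 has label -(j+1) before some corner has label
-j, so the successor of the first corner at level -j is first at the next level. -/
theorem IsFirst.succ
    (hY : ∀ j : ℕ, ∃ n : ℕ, Y.b n = -j) {j : ℕ} {c : Y.Corner} (hc : Y.IsFirst 0 (-j) c) :
    Y.IsFirst 0 (-(j + 1 : ℕ)) (Y.succ c) := by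
  have hs := isLeast_succ hY c
  refine ⟨⟨hc.1.1.trans (cornerIndex_mono hs.1.1.le), ?_⟩, fun d hd => hs.2 ⟨?_, ?_⟩⟩
  · rw [hs.1.2, hc.1.2]; push_cast; ring
  · obtain ⟨d', hd', h1, h2⟩ := exists_corner_eq_of_le (i := 0) (ℓ := -j) (c := d)
      (by rw [Y.b_zero]; omega) hd.1 (by rw [hd.2]; omega)
    refine lt_of_le_of_ne ((hc.2 ⟨h1, h2⟩).trans hd') ?_
    rintro rfl
    have := hc.1.2
    have := hd.2
    omega
  · rw [hd.2, hc.1.2]; push_cast; ring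

theorem exists_maxGeodesic
    (hY : ∀ j : ℕ, ∃ n : ℕ, Y.b n = -j) :
    ∃ c : ℕ → Y.Corner, (∀ j, Y.IsFirst 0 (-(j : ℕ)) (c j)) ∧
    (∀ j, c (j + 1) = Y.succ (c j)) ∧ ∀ j, Y.maxGeodesic j = Y.cornerVertex (c j) := by
  obtain ⟨c, hc⟩ := exists_isFirst hY (i := 0) (ℓ := Y.b 0) le_rfl
  have hroot : Y.root = Y.cornerVertex c := hc.boundaryMap_eq
  have hl := hc.isLeast_vertex
  rw [← hroot] at hl
  have hex : ∃ c, IsLeast {c | Y.cornerVertex c = Y.root} c := ⟨c, hl⟩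
  have hsucc : ∀ j, Y.succ^[j + 1] c = Y.succ (Y.succ^[j] c) := fun j =>
    Function.iterate_succ_apply' _ _ _
  refine ⟨fun j => Y.succ^[j] c, fun j => ?_, hsucc, fun j => ?_⟩
  · induction j with
    | zero => simpa [Y.b_zero] using hc
    | succ j ih =>
      change Y.IsFirst 0 _ (Y.succ^[j + 1] c)
      rw [hsucc]
      exact ih.succ hY
  · rw [maxGeodesic, maxGeodesicFrom, dif_pos hex, hex.choose_spec.unique hl]

/-- Both vertices determine their leftmost corners and these are first corners, so equality of
vertices is equality of corners. -/
theorem boundaryMap_eq_iff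
    (hY : ∀ j : ℕ, ∃ n : ℕ, Y.b n = -j) {i ℓ i₀ : ℤ} {c : Y.Corner} (hc : Y.IsFirst i₀ ℓ c) :
    Y.boundaryMap i = Y.cornerVertex c ↔ Y.b i = ℓ ∧ Y.IsFirst i ℓ c := by
  obtain ⟨d, hd⟩ := exists_isFirst hY (i := i) (ℓ := Y.b i) le_rfl
  rw [hd.boundaryMap_eq]
  constructor
  · intro h
    have h1 := cornerLabel_eq h
    rw [hd.1.2, hc.1.2] at h1
    have h2 := hd.isLeast_vertex
    rw [h] at h2
    rw [h2.unique hc.isLeast_vertex, h1] at hd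
    exact ⟨h1, hd⟩
  · rintro ⟨h1, h2⟩
    rw [h1] at hd
    rw [IsLeast.unique hd h2]

/-- A tree whose root label is at least t and which avoids the label t stays above t, as labels
cannot jump over t. -/
theorem treeOk_of_ne {s : Bool} {n : ℕ} {t : ℤ} (h1 : t ≤ Y.b (edge s n))
    (h : ∀ c, Y.cornerIndex c = edge s n → Y.cornerLabel c ≠ t) :
    TreeOk Y s (fun t => {τ | τ.All (t < ·)}) n t := by
  intro hd
  refine (tree_all_iff hd).2 fun c hc => not_le.1 fun hle => ?_
  obtain ⟨c', h2, h3, h4⟩ := exists_corner_eq_of_le h1 hc.ge hle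
  have := cornerIndex_mono h2
  exact h c' (by omega) h4

/-- If `φ i` is on the geodesic at time j, no tree before i carries the label -j, and the first
visit of the bridge to -j, at or before i, can serve as N. Conversely, admissible trees before N
push the geodesic corner to N or beyond. -/
theorem mem_rightTimes_iff
    (hY : ∀ j : ℕ, ∃ n : ℕ, Y.b n = -j) (j : ℕ) : j ∈ Y.rightTimes ↔
    ∃ N, Reach Y true (fun t => {τ | τ.All (t < ·)}) 0 (-j) N := by
  obtain ⟨c, hc, -, hmax⟩ := exists_maxGeodesic hY
  simp only [rightTimes, rightBoundary, Set.mem_ofPred_eq, Set.mem_image, hmax,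
    boundaryMap_eq_iff hY (hc j)]
  constructor
  · rintro ⟨i, hi, hb, hf⟩
    obtain ⟨n, rfl⟩ : ∃ n : ℕ, i = n := ⟨i.toNat, by omega⟩
    obtain ⟨N, hN, h1, h2⟩ := exists_first_eq (f := fun n => Y.b (pos true n))
      (Y.abs_step_pos true) (ℓ := -j) (n := n)
      (by simp [pos, Y.b_zero]) hb
    refine ⟨N, Nat.zero_le _, h1, fun k _ hk => ⟨h2 k hk, treeOk_of_ne (h2 k hk).le ?_⟩⟩
    intro d hd hl
    have hd' : Y.cornerIndex d = k := hd
    have := cornerIndex_mono ((hc j).2 (show d ∈ _ from ⟨by omega, hl⟩))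
    have := hf.1.1
    omega
  · rintro ⟨N, -, h1, h2⟩
    refine ⟨N, by simp, h1, ⟨?_, (hc j).1.2⟩, fun d hd => (hc j).2 ⟨?_, hd.2⟩⟩
    · by_contra hlt
      obtain ⟨k, hk⟩ : ∃ k : ℕ, Y.cornerIndex (c j) = k :=
        ⟨(Y.cornerIndex (c j)).toNat, by have := (hc j).1.1; omega⟩
      have hmem : edge true k ∈ downSteps Y.b := by
        have := cornerIndex_mem (c j)
        rwa [hk] at this
      have := (tree_all_iff hmem).1 ((h2 k (Nat.zero_le _) (by omega)).2 hmem) (c j) hk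
      have := (hc j).1.2
      omega
    · have := hd.1
      omega

theorem mem_leftTimes_iff
    (hY : ∀ j : ℕ, ∃ n : ℕ, Y.b n = -j) (j : ℕ) : j ∈ Y.leftTimes ↔
    ∃ N, Reach Y false (fun t => {τ | τ.All (t < ·)}) 0 (-j) N := by
  obtain ⟨c, hc, -, hmax⟩ := exists_maxGeodesic hY
  simp only [leftTimes, leftBoundary, Set.mem_ofPred_eq, Set.mem_image, hmax,
    boundaryMap_eq_iff hY (hc j)]
  constructor
  · rintro ⟨i, hi, hb, hf⟩
    obtain ⟨n, rfl⟩ : ∃ n : ℕ, i = -n := ⟨(-i).toNat, by omega⟩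
    obtain ⟨N, hN, h1, h2⟩ := exists_first_eq (f := fun n => Y.b (pos false n))
      (Y.abs_step_pos false) (ℓ := -j) (n := n)
      (by simp [pos, Y.b_zero]) hb
    refine ⟨N, Nat.zero_le _, h1, fun k _ hk => ⟨h2 k hk, treeOk_of_ne ?_ ?_⟩⟩
    -- The tree of this edge has its root at the next point, which may be the N-th one; there the
    -- bound is an equality.
    · have : edge false k = pos false (k + 1) := by simp [edge, pos]; ring
      rw [this]
      rcases Nat.lt_or_ge (k + 1) N with h | h
      · exact (h2 _ h).le
      · rw [show k + 1 = N by omega, h1]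
    · intro d hd hl
      have hd' : Y.cornerIndex d = -k - 1 := hd
      have := cornerIndex_mono (hf.2 (show d ∈ _ from ⟨by omega, hl⟩))
      have := (hc j).1.1
      omega
  · rintro ⟨N, -, h1, h2⟩
    refine ⟨-N, by simp, h1, ⟨?_, (hc j).1.2⟩, fun d hd => (hc j).2 ⟨?_, hd.2⟩⟩
    · have := (hc j).1.1
      omega
    -- A corner with label -j between -N and 0 would lie in one of the admissible trees.
    · by_contra hlt
      obtain ⟨k, hk⟩ : ∃ k : ℕ, Y.cornerIndex d = -k - 1 :=
        ⟨(-Y.cornerIndex d - 1).toNat, by omega⟩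
      have hmem : edge false k ∈ downSteps Y.b := by
        have := cornerIndex_mem d
        rwa [hk] at this
      have h3 := hd.1
      have := (tree_all_iff hmem).1 ((h2 k (Nat.zero_le _) (by omega)).2 hmem) d hk
      have := hd.2
      omega

theorem vertexLabel_maxGeodesic
    (hY : ∀ j : ℕ, ∃ n : ℕ, Y.b n = -j) (j : ℕ) : Y.vertexLabel (Y.maxGeodesic j) = -j := by
  obtain ⟨c, hc, -, hmax⟩ := exists_maxGeodesic hY
  rw [hmax, vertexLabel_cornerVertex, (hc j).1.2]

theorem maxGeodesic_injective
    (hY : ∀ j : ℕ, ∃ n : ℕ, Y.b n = -j) : Function.Injective Y.maxGeodesic := by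
  intro i j h
  have := vertexLabel_maxGeodesic hY i
  rw [h, vertexLabel_maxGeodesic hY j] at this
  omega

/-- Each edge joins a corner to its successor, so labels are 1-Lipschitz for the graph distance;
this gives the lower bound on distances along the geodesic. -/
theorem abs_vertexLabel_sub_le
    (hY : ∀ j : ℕ, ∃ n : ℕ, Y.b n = -j) {u v : Vertex} (w : Y.graph.Walk u v) :
    |Y.vertexLabel u - Y.vertexLabel v| ≤ w.length := by
  induction w with
  | nil => simp
  | cons h w ih =>
    have key : ∀ c, |Y.vertexLabel (Y.cornerVertex c) -
        Y.vertexLabel (Y.cornerVertex (Y.succ c))| = 1 := fun c => by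
      rw [vertexLabel_cornerVertex, vertexLabel_cornerVertex, (isLeast_succ hY c).1.2]
      simp
    rw [graph, SimpleGraph.fromRel_adj] at h
    rw [SimpleGraph.Walk.length_cons]
    push_cast
    refine (abs_sub_le _ _ _).trans ((add_le_add_right ih _).trans ?_)
    rcases h.2 with ⟨c, rfl, rfl⟩ | ⟨c, rfl, rfl⟩
    · rw [key]; omega
    · rw [abs_sub_comm, key]; omega

theorem isGeodesicRay_maxGeodesic
    (hY : ∀ j : ℕ, ∃ n : ℕ, Y.b n = -j) : IsGeodesicRay Y.graph Y.maxGeodesic := by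
  obtain ⟨c, hc, hsucc, hmax⟩ := exists_maxGeodesic hY
  have hadj : ∀ j, Y.graph.Adj (Y.maxGeodesic j) (Y.maxGeodesic (j + 1)) := fun j => by
    rw [graph, SimpleGraph.fromRel_adj]
    refine ⟨fun h => by simpa using maxGeodesic_injective hY h, Or.inl ⟨c j, (hmax j).symm, ?_⟩⟩
    rw [hmax, hsucc]
  have hwalk : ∀ i k, ∃ w : Y.graph.Walk (Y.maxGeodesic i) (Y.maxGeodesic (i + k)),
      w.length = k := by
    intro i k
    induction k with
    | zero => exact ⟨.nil, rfl⟩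
    | succ k ih =>
      obtain ⟨w, hw⟩ := ih
      exact ⟨w.concat (hadj _), by simp [hw]⟩
  have key : ∀ i k, Y.graph.dist (Y.maxGeodesic i) (Y.maxGeodesic (i + k)) = k := by
    intro i k
    obtain ⟨w, hw⟩ := hwalk i k
    refine le_antisymm ((SimpleGraph.dist_le w).trans hw.le) ?_
    obtain ⟨w', hw'⟩ := w.reachable.exists_walk_length_eq_dist
    have := abs_vertexLabel_sub_le hY w'
    rw [vertexLabel_maxGeodesic hY, vertexLabel_maxGeodesic hY, hw'] at this
    have := (abs_le.1 this).2
    push_cast at this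
    omega
  intro i j
  rcases le_total i j with h | h
  · obtain ⟨k, rfl⟩ := Nat.exists_eq_add_of_le h
    rw [key]; omega
  · obtain ⟨k, rfl⟩ := Nat.exists_eq_add_of_le h
    rw [SimpleGraph.dist_comm, key]; omega

end TreedBridge

end UIHPQ

/-! ### Renewal sets and asymptotic frequency -/

namespace UIHPQ

section Renewal

variable {Ω : Type*} [MeasurableSpace Ω] {P : Measure Ω} [IsProbabilityMeasure P] {R : ℕ → Set Ω}

/-- Inclusion-exclusion, one index at a time: excluding a equals the event without condition on a
minus the event with a moved into S. -/
theorem measureReal_renewal_sdiff (hR : ∀ j, MeasurableSet (R j))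
    (hren : ∀ (j : ℕ) (S : Finset ℕ),
      P.real (R j ∩ ⋂ k ∈ S, R (j + k)) = P.real (R j) * P.real (⋂ k ∈ S, R k))
    (j : ℕ) (F S : Finset ℕ) :
    P.real ((R j ∩ ⋂ k ∈ S, R (j + k)) \ ⋃ k ∈ F, R (j + k)) =
      P.real (R j) * P.real ((⋂ k ∈ S, R k) \ ⋃ k ∈ F, R k) := by
  classical
  induction F using Finset.induction_on generalizing S with
  | empty => simpa using hren j S
  | insert a F ha ih =>
    have h1 := measureReal_inter_add_sdiff (μ := P)
      (s := (R j ∩ ⋂ k ∈ S, R (j + k)) \ ⋃ k ∈ F, R (j + k)) (hR (j + a))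
    have h2 := measureReal_inter_add_sdiff (μ := P)
      (s := (⋂ k ∈ S, R k) \ ⋃ k ∈ F, R k) (hR a)
    have e1 : ((R j ∩ ⋂ k ∈ S, R (j + k)) \ ⋃ k ∈ F, R (j + k)) ∩ R (j + a) =
        (R j ∩ ⋂ k ∈ insert a S, R (j + k)) \ ⋃ k ∈ F, R (j + k) := by
      ext ω
      simp only [Set.mem_inter_iff, Set.mem_sdiff, Set.mem_iInter, Finset.forall_mem_insert]
      tauto
    have e2 : ((⋂ k ∈ S, R k) \ ⋃ k ∈ F, R k) ∩ R a =
        (⋂ k ∈ insert a S, R k) \ ⋃ k ∈ F, R k := by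
      ext ω
      simp only [Set.mem_inter_iff, Set.mem_sdiff, Set.mem_iInter, Finset.forall_mem_insert]
      tauto
    have e3 : ((R j ∩ ⋂ k ∈ S, R (j + k)) \ ⋃ k ∈ F, R (j + k)) \ R (j + a) =
        (R j ∩ ⋂ k ∈ S, R (j + k)) \ ⋃ k ∈ insert a F, R (j + k) := by
      rw [Finset.set_biUnion_insert, Set.union_comm, Set.sdiff_sdiff]
    have e4 : ((⋂ k ∈ S, R k) \ ⋃ k ∈ F, R k) \ R a =
        (⋂ k ∈ S, R k) \ ⋃ k ∈ insert a F, R k := by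
      rw [Finset.set_biUnion_insert, Set.union_comm, Set.sdiff_sdiff]
    rw [e1, e3, ih, ih] at h1
    rw [e2, e4] at h2
    rw [← h2, mul_add] at h1
    linarith

/-- A renewal set whose renewal function has infinite sum is almost surely infinite. -/
theorem ae_infinite_of_renewal (hR : ∀ j, MeasurableSet (R j)) (h0 : R 0 = Set.univ)
    (hren : ∀ (j : ℕ) (S : Finset ℕ),
      P.real (R j ∩ ⋂ k ∈ S, R (j + k)) = P.real (R j) * P.real (⋂ k ∈ S, R k))
    (hsum : ¬ Summable fun j => P.real (R j)) : ∀ᵐ ω ∂P, {j | ω ∈ R j}.Infinite := by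
  -- The event that j is a renewal not followed by another within K units. For j < K these are
  -- disjoint, so the sum of P(R j) over j < K, times q K, is at most 1, and q K tends to 0.
  set D : ℕ → ℕ → Set Ω := fun K j => R j \ ⋃ k ∈ Finset.Icc 1 K, R (j + k) with hD
  set q : ℕ → ℝ := fun K => P.real (Set.univ \ ⋃ k ∈ Finset.Icc 1 K, R k) with hq
  have hDq : ∀ K j, P.real (D K j) = P.real (R j) * q K := fun K j => by
    simpa [hD, hq] using measureReal_renewal_sdiff hR hren j (Finset.Icc 1 K) ∅
  have hDm : ∀ K j, MeasurableSet (D K j) := fun K j =>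
    (hR j).diff (Finset.measurableSet_biUnion _ fun k _ => hR _)
  have hle : ∀ K, (∑ j ∈ Finset.range K, P.real (R j)) * q K ≤ 1 := by
    intro K
    rw [Finset.sum_mul, ← Finset.sum_congr rfl fun j _ => hDq K j,
      ← measureReal_biUnion_finset _ fun j _ => hDm K j]
    · exact measureReal_le_one
    · have key : ∀ i j, j < K → i < j → Disjoint (D K i) (D K j) := fun i j hj hij => by
        refine Set.disjoint_left.2 fun ω hi hj' => hi.2 ?_
        refine Set.mem_biUnion (x := j - i) ?_ ?_
        · simp; omega
        · rw [Nat.add_sub_cancel' hij.le]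
          exact hj'.1
      intro i hi j hj hij
      simp only [Finset.coe_range, Set.mem_Iio] at hi hj
      rcases lt_or_gt_of_ne hij with h | h
      · exact key i j hj h
      · exact (key j i hi h).symm
  have htop := (not_summable_iff_tendsto_nat_atTop_of_nonneg fun j =>
    (measureReal_nonneg : 0 ≤ P.real (R j))).1 hsum
  have hqlim : Tendsto q atTop (𝓝 0) := by
    refine squeeze_zero' (Eventually.of_forall fun K => measureReal_nonneg) ?_
      (tendsto_inv_atTop_zero.comp htop)
    filter_upwards [htop.eventually_gt_atTop 0] with K hK
    rw [Function.comp_apply, ← one_div, le_div_iff₀ hK, mul_comm]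
    exact hle K
  have hnull : ∀ j, P (R j \ ⋃ k, R (j + (k + 1))) = 0 := by
    intro j
    rw [← measureReal_eq_zero_iff]
    refine le_antisymm (ge_of_tendsto' hqlim fun K => ?_) measureReal_nonneg
    calc P.real (R j \ ⋃ k, R (j + (k + 1))) ≤ P.real (D K j) := by
          refine measureReal_mono fun ω hω => ⟨hω.1, fun h => hω.2 ?_⟩
          simp only [Set.mem_iUnion, Finset.mem_Icc] at h ⊢
          obtain ⟨k, ⟨h1, -⟩, h2⟩ := h
          exact ⟨k - 1, by rwa [Nat.sub_add_cancel h1]⟩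
      _ = P.real (R j) * q K := hDq K j
      _ ≤ q K := mul_le_of_le_one_left measureReal_nonneg measureReal_le_one
  have hae : ∀ᵐ ω ∂P, ∀ j, ω ∉ R j \ ⋃ k, R (j + (k + 1)) :=
    ae_all_iff.2 fun j => measure_eq_zero_iff_ae_notMem.1 (hnull j)
  filter_upwards [hae] with ω hω
  have hnext : ∀ j, ω ∈ R j → ∃ i, ω ∈ R i ∧ j < i := by
    intro j hj
    by_contra hcon
    refine hω j ⟨hj, fun h => hcon ?_⟩
    obtain ⟨k, hk⟩ := Set.mem_iUnion.1 h
    exact ⟨_, hk, by omega⟩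
  refine Set.infinite_of_forall_exists_gt fun n => ?_
  induction n with
  | zero => exact hnext 0 (by rw [h0]; trivial)
  | succ n ih =>
    obtain ⟨i, hi, hni⟩ := ih
    rcases eq_or_lt_of_le (Nat.succ_le_of_lt hni) with h | h
    · subst h; exact hnext _ hi
    · exact ⟨i, hi, h⟩

/-- The proportion is a sum over j ∈ A with j ≤ n of 1/n. Each term is at most 1/j and tends to 0,
so dominated convergence applies. -/
theorem hasAsymptoticFrequency_zero {A : Set ℕ}
    (hA : Summable (A.indicator fun j : ℕ => 1 / (j : ℝ))) : HasAsymptoticFrequency A 0 := by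
  classical
  have key : ∀ n : ℕ, ((A ∩ Set.Icc 1 n).ncard : ℝ) / n =
      ∑' j : ℕ, if j ∈ A ∧ j ∈ Finset.Icc 1 n then 1 / (n : ℝ) else 0 := by
    intro n
    rw [tsum_eq_sum (s := {j ∈ Finset.Icc 1 n | j ∈ A})]
    · have : A ∩ Set.Icc 1 n = ({j ∈ Finset.Icc 1 n | j ∈ A} : Finset ℕ) := by
        ext j; simp only [Set.mem_inter_iff, Set.mem_Icc, Finset.coe_filter, Finset.mem_Icc,
          Set.mem_ofPred_eq]; tauto
      rw [this, Set.ncard_coe_finset, Finset.sum_congr rfl fun j hj => if_pos (by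
        rw [Finset.mem_filter] at hj; exact hj.symm), Finset.sum_const, nsmul_eq_mul, mul_one_div]
    · intro j hj
      rw [if_neg]
      rwa [Finset.mem_filter, and_comm] at hj
  unfold HasAsymptoticFrequency
  simp only [key]
  suffices h : Tendsto (fun n : ℕ => ∑' j : ℕ,
      if j ∈ A ∧ j ∈ Finset.Icc 1 n then 1 / (n : ℝ) else 0) atTop (𝓝 (∑' _ : ℕ, 0)) by rwa [tsum_zero] at h
  refine tendsto_tsum_of_dominated_convergence hA (fun j => ?_) (Eventually.of_forall fun n j => ?_)
  · refine squeeze_zero (g := fun n : ℕ => 1 / (n : ℝ)) (fun n => ?_) (fun n => ?_)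
      tendsto_one_div_atTop_nhds_zero_nat
    · split_ifs <;> positivity
    · split_ifs
      · exact le_rfl
      · positivity
  · rw [Set.indicator_apply]
    split_ifs with h1 h2 h2
    · rw [Real.norm_of_nonneg (by positivity)]
      have := Finset.mem_Icc.1 h1.2
      exact one_div_le_one_div_of_le (by exact_mod_cast this.1) (by exact_mod_cast this.2)
    · exact absurd h1.1 h2
    · simp
    · simp

/-- By Tonelli, the random sum of 1/j over the set has finite mean, hence is almost surely finite.
-/
theorem ae_hasAsymptoticFrequency_zero (hR : ∀ j, MeasurableSet (R j))
    (hsum : Summable fun j : ℕ => P.real (R j) * (1 / (j : ℝ))) :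
    ∀ᵐ ω ∂P, HasAsymptoticFrequency {j | ω ∈ R j} 0 := by
  set f : ℕ → Ω → ℝ≥0∞ := fun j => (R j).indicator fun _ => ENNReal.ofReal (1 / (j : ℝ)) with hf
  have hfm : ∀ j, Measurable (f j) := fun j => measurable_const.indicator (hR j)
  have hint : ∫⁻ ω, ∑' j, f j ω ∂P ≠ ∞ := by
    rw [lintegral_tsum fun j => (hfm j).aemeasurable]
    have : ∀ j, ∫⁻ ω, f j ω ∂P = ENNReal.ofReal (P.real (R j) * (1 / (j : ℝ))) := fun j => by
      rw [lintegral_indicator_const (hR j), ENNReal.ofReal_mul measureReal_nonneg, mul_comm,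
        ofReal_measureReal]
    simp only [this]
    exact hsum.tsum_ofReal_ne_top
  filter_upwards [ae_lt_top (Measurable.tsum hfm) hint] with ω hω
  apply hasAsymptoticFrequency_zero
  have := ENNReal.summable_toReal hω.ne
  refine this.congr fun j => ?_
  by_cases h : ω ∈ R j <;> simp [hf, Set.indicator, h]

end Renewal

/-! ### Renewal property of the reached levels -/

/-- A tree admissible for a level is admissible for every lower level, so reaching the levels one
after the other amounts to reaching each from the start. -/
theorem chain_iff_forall {Y : TreedBridge} {s : Bool} {C : ℤ → Set LTree} (hC : Antitone C)
    {m : ℕ} {L : List ℤ} (hL : L.Pairwise (· ≥ ·)) :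
    Chain Y s C m L ↔ ∀ t ∈ L, ∃ N, Reach Y s C m t N := by
  induction L generalizing m with
  | nil => simp [Chain]
  | cons t L ih =>
    rw [List.pairwise_cons] at hL
    rw [List.forall_mem_cons, Chain, ← exists_and_right]
    refine exists_congr fun N => and_congr_right fun hN => ?_
    rw [ih hL.2]
    refine forall₂_congr fun t' ht' => exists_congr fun N' => ?_
    have htt := hL.1 t' ht'
    constructor
    · rintro ⟨h1, h2, h3⟩
      refine ⟨hN.1.trans h1, h2, fun n hn hn' => ?_⟩
      rcases lt_or_ge n N with h | h
      · obtain ⟨h4, h5⟩ := hN.2.2 n hn h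
        exact ⟨by omega, fun hd => hC htt (h5 hd)⟩
      · exact h3 n h hn'
    · rintro ⟨h1, h2, h3⟩
      refine ⟨not_lt.1 fun h => ?_, h2, fun n hn => h3 n (hN.1.trans hn)⟩
      have := (hN.2.2 N' h1 h).1
      omega

theorem gapProd_map_add (g : ℕ → ℝ) (x c : ℤ) (L : List ℤ) :
    gapProd g (x + c) (L.map (· + c)) = gapProd g x L := by
  induction L generalizing x with
  | nil => rfl
  | cons t L ih => rw [List.map_cons, gapProd, gapProd, ih, add_sub_add_right_eq_sub]

theorem antitone_all_gt : Antitone fun t : ℤ => {τ : LTree | τ.All (t < ·)} := by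
  intro t t' htt τ hτ
  have hF : ∀ F : LForest, F.All (t' < ·) → F.All (t < ·) := by
    intro F
    induction F with
    | nil => exact fun _ => trivial
    | cons ℓ s r hs hr => exact fun h => ⟨htt.trans_lt h.1, hs h.2.1, hr h.2.2⟩
  exact ⟨htt.trans_lt hτ.1, hF _ hτ.2⟩

section

variable {Ω : Type*} [MeasurableSpace Ω] {P : Measure Ω} [IsProbabilityMeasure P]
  {X : Ω → TreedBridge} {s : Bool} {C : ℤ → Set LTree}

/-- The event that the walk read on one side reaches the level `-j` after meeting only trees in
`C (-j)`. -/
def reachEvent {Ω : Type*} (X : Ω → TreedBridge) (s : Bool) (C : ℤ → Set LTree) (j : ℕ) : Set Ω :=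
  {ω | ∃ N, Reach (X ω) s C 0 (-j) N}

theorem reachEvent_zero {Ω : Type*} (X : Ω → TreedBridge) (s : Bool) (C : ℤ → Set LTree) :
    reachEvent X s C 0 = Set.univ := by
  refine Set.eq_univ_of_forall fun ω => ⟨0, le_rfl, ?_, fun n _ hn => absurd hn (by omega)⟩
  cases s <;> simp [pos, (X ω).b_zero]

theorem measurableSet_reachEvent {P : Measure Ω} (hX : IsUniformInfiniteTreedBridge P X) (j : ℕ) :
    MeasurableSet (reachEvent X s C j) := by
  have hok : ∀ n, MeasurableSet {ω | TreeOk (X ω) s C n (-j)} := fun n => by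
    have : {ω | TreeOk (X ω) s C n (-j)} =
        (treeEvent X (edge s n) Set.univ)ᶜ ∪ treeEvent X (edge s n) (C (-j)) := by
      ext ω
      by_cases h : edge s n ∈ downSteps (X ω).b <;> simp [TreeOk, treeEvent, h]
    rw [this]
    exact (hX.measurableSet_treeEvent _ _).compl.union (hX.measurableSet_treeEvent _ _)
  have : reachEvent X s C j = ⋃ N : ℕ, ({ω | (X ω).b (pos s N) = -j} ∩
      ⋂ n ∈ Set.Iio N, ({ω | -(j : ℤ) < (X ω).b (pos s n)} ∩
        {ω | TreeOk (X ω) s C n (-j)})) := by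
    ext ω
    simp [reachEvent, Reach]
  rw [this]
  refine MeasurableSet.iUnion fun N => ?_
  refine (hX.measurable_bridge _ (measurableSet_singleton _)).inter ?_
  refine MeasurableSet.biInter (Set.to_countable _) fun n _ => MeasurableSet.inter ?_ (hok n)
  exact hX.measurable_bridge _ measurableSet_Ioi

theorem measure_reachEvent (hX : IsUniformInfiniteTreedBridge P X) {q g : ℕ → ℝ}
    (hg : IsReachProb s C q g) (j : ℕ) : P.real (reachEvent X s C j) = g j := by
  have := measure_chain hX hg [-(j : ℤ)] (x := 0) (by simp) (isAtom_univ X s)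
  simpa [gapProd, Chain, reachEvent] using this

/-- Sorting S turns the intersection into a chain of decreasing levels. Its probability depends only
on the gaps, so the part after -j is a translate of the chain from 0. -/
theorem measure_reachEvent_inter (hX : IsUniformInfiniteTreedBridge P X) {q g : ℕ → ℝ}
    (hg : IsReachProb s C q g) (hC : Antitone C) (j : ℕ) (S : Finset ℕ) :
    P.real (reachEvent X s C j ∩ ⋂ k ∈ S, reachEvent X s C (j + k)) =
      P.real (reachEvent X s C j) * P.real (⋂ k ∈ S, reachEvent X s C k) := by
  set L : List ℤ := (S.sort (· ≤ ·)).map fun k : ℕ => -(k : ℤ) with hLdef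
  have hL : (0 :: L).Pairwise (· ≥ ·) := by
    rw [List.pairwise_cons]
    constructor
    · simp [hLdef]
    · rw [hLdef, List.pairwise_map]
      exact (S.pairwise_sort (· ≤ ·)).imp fun h => by simpa using h
  set L' : List ℤ := L.map (· + -(j : ℤ)) with hLdef'
  have hL' : (-(j : ℤ) :: L').Pairwise (· ≥ ·) := by
    have := hL.map (fun t : ℤ => t + -(j : ℤ)) (S := (· ≥ ·)) fun a b h => by simpa using h
    simpa [hLdef'] using this
  have hL0 : (0 :: -(j : ℤ) :: L').Pairwise (· ≥ ·) := by
    rw [List.pairwise_cons]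
    refine ⟨fun t ht => ?_, hL'⟩
    rcases List.mem_cons.1 ht with rfl | ht
    · simp
    · have := (List.pairwise_cons.1 hL').1 t ht
      omega
  have e1 : (⋂ k ∈ S, reachEvent X s C k) = Set.univ ∩ {ω | Chain (X ω) s C 0 L} := by
    ext ω
    simp only [Set.univ_inter, Set.mem_ofPred_eq, chain_iff_forall hC (List.pairwise_cons.1 hL).2]
    simp [hLdef, reachEvent]
  have e2 : (reachEvent X s C j ∩ ⋂ k ∈ S, reachEvent X s C (j + k)) =
      Set.univ ∩ {ω | Chain (X ω) s C 0 (-(j : ℤ) :: L')} := by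
    ext ω
    simp only [Set.univ_inter, Set.mem_ofPred_eq, chain_iff_forall hC hL']
    simp [hLdef, hLdef', reachEvent, add_comm]
  rw [e1, e2, measure_chain hX hg _ (List.isChain_iff_pairwise.2 hL0) (isAtom_univ X s),
    measure_chain hX hg _ (List.isChain_iff_pairwise.2 hL) (isAtom_univ X s),
    measure_reachEvent hX hg, gapProd]
  have := gapProd_map_add g 0 (-(j : ℤ)) L
  rw [zero_add] at this
  rw [this]
  simp

end

end UIHPQ

/-! ### The proposition -/

theorem proposition3 {Ω : Type*} [MeasurableSpace Ω] (P : Measure Ω) [IsProbabilityMeasure P]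
    (X : Ω → UIHPQ.TreedBridge) (hX : UIHPQ.IsUniformInfiniteTreedBridge P X) :
    (∀ i : ℕ, 1 ≤ i →
      P.real {ω | i ∈ (X ω).rightTimes} = 1 / ((i : ℝ) + 1) ∧
      P.real {ω | i ∈ (X ω).leftTimes} = 3 / ((i : ℝ) + 3)) ∧
    (∀ᵐ ω ∂P, (X ω).rightTimes.Infinite ∧ (X ω).leftTimes.Infinite) ∧
    (∀ᵐ ω ∂P, UIHPQ.IsGeodesicRay (X ω).graph (X ω).maxGeodesic ∧
      (Set.range (X ω).maxGeodesic ∩ (X ω).rightBoundary).Infinite ∧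
      (Set.range (X ω).maxGeodesic ∩ (X ω).leftBoundary).Infinite) ∧
    (∀ᵐ ω ∂P, UIHPQ.HasAsymptoticFrequency (X ω).rightTimes 0 ∧
      UIHPQ.HasAsymptoticFrequency (X ω).leftTimes 0) := by
  have hY := UIHPQ.ae_exists_eq_neg hX
  set C : ℤ → Set UIHPQ.LTree := fun t => {τ | τ.All (t < ·)} with hC
  have hr : ∀ᵐ ω ∂P, (X ω).rightTimes = {j | ω ∈ UIHPQ.reachEvent X true C j} := by
    filter_upwards [hY] with ω hω
    ext j
    exact UIHPQ.TreedBridge.mem_rightTimes_iff hω j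
  have hl : ∀ᵐ ω ∂P, (X ω).leftTimes = {j | ω ∈ UIHPQ.reachEvent X false C j} := by
    filter_upwards [hY] with ω hω
    ext j
    exact UIHPQ.TreedBridge.mem_leftTimes_iff hω j
  have hgr := UIHPQ.isReachProb_right
  have hgl := UIHPQ.isReachProb_left
  have hmr := fun j => UIHPQ.measurableSet_reachEvent (s := true) (C := C) hX j
  have hml := fun j => UIHPQ.measurableSet_reachEvent (s := false) (C := C) hX j
  have hpr : ∀ j, P.real (UIHPQ.reachEvent X true C j) = 1 / ((j : ℝ) + 1) :=
    UIHPQ.measure_reachEvent hX hgr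
  have hpl : ∀ j, P.real (UIHPQ.reachEvent X false C j) = 3 / ((j : ℝ) + 3) :=
    UIHPQ.measure_reachEvent hX hgl
  have hinf : ∀ᵐ ω ∂P, (X ω).rightTimes.Infinite ∧ (X ω).leftTimes.Infinite := by
    have h1 := UIHPQ.ae_infinite_of_renewal hmr (UIHPQ.reachEvent_zero X true C)
      (UIHPQ.measure_reachEvent_inter hX hgr UIHPQ.antitone_all_gt) (by
        simp only [hpr]
        intro h
        refine Real.not_summable_one_div_natCast ((summable_nat_add_iff 1).1 ?_)
        simpa using h)
    have h2 := UIHPQ.ae_infinite_of_renewal hml (UIHPQ.reachEvent_zero X false C)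
      (UIHPQ.measure_reachEvent_inter hX hgl UIHPQ.antitone_all_gt) (by
        simp only [hpl]
        intro h
        refine Real.not_summable_one_div_natCast ((summable_nat_add_iff 3).1 ?_)
        refine (h.mul_left (1 / 3)).congr fun j => ?_
        push_cast
        field_simp)
    filter_upwards [h1, h2, hr, hl] with ω h1 h2 hr hl
    rw [hr, hl]
    exact ⟨h1, h2⟩
  refine ⟨fun i _ => ⟨?_, ?_⟩, hinf, ?_, ?_⟩
  · rw [← hpr i]
    refine measureReal_congr ?_
    filter_upwards [hr] with ω hω
    exact congrArg (i ∈ ·) hω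
  · rw [← hpl i]
    refine measureReal_congr ?_
    filter_upwards [hl] with ω hω
    exact congrArg (i ∈ ·) hω
  · filter_upwards [hY, hinf] with ω hω h
    have hinj := UIHPQ.TreedBridge.maxGeodesic_injective hω
    refine ⟨UIHPQ.TreedBridge.isGeodesicRay_maxGeodesic hω, ?_, ?_⟩
    · refine (h.1.image hinj.injOn).mono ?_
      rintro _ ⟨j, hj, rfl⟩
      exact ⟨⟨j, rfl⟩, hj⟩
    · refine (h.2.image hinj.injOn).mono ?_
      rintro _ ⟨j, hj, rfl⟩
      exact ⟨⟨j, rfl⟩, hj⟩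
  -- Both 1/(j+1) and 3/(j+3) are at most 3/j, so 3/j² dominates the two series.
  · have hs : Summable fun j : ℕ => 3 * (1 / (j : ℝ) ^ 2) :=
      (Real.summable_one_div_nat_pow.2 one_lt_two).mul_left 3
    have hle : ∀ (j : ℕ) (x : ℝ), x * j ≤ 3 → x * (1 / (j : ℝ)) ≤ 3 * (1 / (j : ℝ) ^ 2) := by
      intro j x hx
      rcases Nat.eq_zero_or_pos j with rfl | hj
      · simp
      · have : (0 : ℝ) < j := by exact_mod_cast hj
        rw [mul_one_div, mul_one_div, div_le_div_iff₀ this (by positivity)]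
        nlinarith
    have h1 := UIHPQ.ae_hasAsymptoticFrequency_zero (P := P) hmr (by
      refine hs.of_nonneg_of_le (fun j => by positivity) fun j => hle j _ ?_
      rw [hpr, one_div_mul_eq_div, div_le_iff₀ (by positivity)]
      linarith [(j.cast_nonneg : (0 : ℝ) ≤ j)])
    have h2 := UIHPQ.ae_hasAsymptoticFrequency_zero (P := P) hml (by
      refine hs.of_nonneg_of_le (fun j => by positivity) fun j => hle j _ ?_
      rw [hpl, div_mul_eq_mul_div, div_le_iff₀ (by positivity)]
      linarith)
    filter_upwards [h1, h2, hr, hl] with ω h1 h2 hr hl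
    rw [hr, hl]
    exact ⟨h1, h2⟩
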